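/- Let $\mathbb T=([0,+\infty],\min,+)$ be the tropical semiring (its zero is $+\infty$, its one is the number $0$). Let $n\ge 1$ and let $s=\sum_\mu s_\mu x^\mu\neq 0$ be a polynomial in $n$ variables over $\mathbb T$, with support $\mathrm{supp}(s)=\{\mu\in\mathbb N^n : s_\mu\neq+\infty\}$, and let $|s|:=\#\mathrm{supp}(s)\ge 1$. Let $NP(s)\subseteq\mathbb R^n$ be the convex hull of $\mathrm{supp}(s)$, let $\mathrm{Vert}(NP(s))\subseteq\mathbb N^n$ be its set of vertices, let $V_{\min}(s)$ be the set of the minimal elements of $\mathrm{Vert}(NP(s))$ for the pointwise order of $\mathbb N^n$, let $NP_{\min}(s)$ be the convex hull of $V_{\min}(s)$, and let $s_{\min}:=\sum_{\mu\in V_{\min}(s)}x^\mu$ (all non-zero coefficients are the one of $\mathbb T$). Then $\mathrm{supp}(s_{\min})=\mathrm{Vert}(NP_{\min}(s))$, and $s_{\min}$ can be computed by a randomised algorithm in expected time $O(n|s|^{\max\{2,n\}})$. That is, there are a single program $P$ of the randomised real RAM (integer and real memory cells with indirect addressing; memory accesses, arithmetic operations, comparisons and the drawing of a uniform random integer in $\{0,\dots,b\}$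 each take one unit of time) and a constant $C$ such that, for all $n\geq 1$ and all $s\neq 0$ as above, when $P$ is started on any memory that holds $n$, $|s|$ and the list of the terms of $s$ (coefficient and $n$ exponents), in any order and without repetition, $P$ halts with probability $1$ with a memory that holds $s_{\min}$ in the same format, and its expected running time is at most $C\,n\,|s|^{\max\{2,n\}}$. -/

import Mathlib

open scoped ENNReal

noncomputable section

/-! ### Tropical polynomials and their (minimal) Newton polytopes -/

namespace TropPoly

/-- The tropical semiring `([0,+∞], min, +)`: its zero is `+∞` and its one is the number `0`. -/
abbrev 𝕋 : Type := Tropical ℝ≥0∞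

/-- A monomial, that is an exponent vector in `ℕⁿ`, as a point of `ℝⁿ`. -/
def toPoint {n : ℕ} (μ : Fin n →₀ ℕ) : Fin n → ℝ := fun j => (μ j : ℝ)

/-- The Newton polytope: the convex hull of the support. -/
def NP {n : ℕ} (s : MvPolynomial (Fin n) 𝕋) : Set (Fin n → ℝ) :=
  convexHull ℝ (toPoint '' (s.support : Set (Fin n →₀ ℕ)))

/-- The monomials that are vertices (extreme points) of the Newton polytope. -/
def vertNP {n : ℕ} (s : MvPolynomial (Fin n) 𝕋) : Set (Fin n →₀ ℕ) :=
  {μ | toPoint μ ∈ Set.extremePoints ℝ (NP s)}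

/-- The minimal elements of the vertices of `NP s`, for the pointwise order of `ℕⁿ`. -/
def vertNPmin {n : ℕ} (s : MvPolynomial (Fin n) 𝕋) : Set (Fin n →₀ ℕ) :=
  {μ | Minimal (fun ν => ν ∈ vertNP s) μ}

/-- The minimal Newton polytope. -/
def NPmin {n : ℕ} (s : MvPolynomial (Fin n) 𝕋) : Set (Fin n → ℝ) :=
  convexHull ℝ (toPoint '' vertNPmin s)

open Classical in
/-- The all-one polynomial whose monomials are those of `vertNPmin s` (a subset of the support). -/
def sMin {n : ℕ} (s : MvPolynomial (Fin n) 𝕋) : MvPolynomial (Fin n) 𝕋 :=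
  ∑ μ ∈ s.support.filter (fun μ => μ ∈ vertNPmin s), MvPolynomial.monomial μ 1

end TropPoly

/-! ### Randomised real RAM

The unit-cost model of computational geometry: a memory of integer cells (used for counters and
addresses) and a memory of real cells, both with indirect addressing; one unit of time for each
memory access, arithmetic operation, comparison, and random draw. Programs are finite and have
structured control flow. -/

namespace RealRAM

/-- The memory: cell `a` of the integer part holds `int a`, cell `a` of the real part `real a`. -/
structure Mem where
  int : ℕ → ℕ
  real : ℕ → ℝ

/-- Integer expressions. `load a` is the content of the integer cell whose address is `a`. -/
inductive IExpr where
  | const (k : ℕ)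
  | load (a : IExpr)
  | add (a b : IExpr)
  | sub (a b : IExpr)
  | mul (a b : IExpr)

/-- Real expressions. `load a` is the content of the real cell whose address is `a`. -/
inductive RExpr where
  | const (k : ℤ)
  | load (a : IExpr)
  | add (a b : RExpr)
  | sub (a b : RExpr)
  | mul (a b : RExpr)
  | div (a b : RExpr)

/-- Tests. -/
inductive Test where
  | ile (a b : IExpr)
  | rle (a b : RExpr)
  | neg (p : Test)
  | conj (p q : Test)

/-- Programs. -/
inductive Prog where
  | skip
  | istore (addr val : IExpr)
  | rstore (addr : IExpr) (val : RExpr)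
  | rand (addr bound : IExpr)
  | seq (p q : Prog)
  | ite (b : Test) (p q : Prog)
  | loop (b : Test) (p : Prog)

/-- Value of an integer expression; subtraction is truncated at `0`. -/
def IExpr.eval (M : Mem) : IExpr → ℕ
  | .const k => k
  | .load a => M.int (a.eval M)
  | .add a b => a.eval M + b.eval M
  | .sub a b => a.eval M - b.eval M
  | .mul a b => a.eval M * b.eval M

/-- Value of a real expression; a quotient by `0` is `0`. -/
def RExpr.eval (M : Mem) : RExpr → ℝ
  | .const k => (k : ℝ)
  | .load a => M.real (a.eval M)
  | .add a b => a.eval M + b.eval M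
  | .sub a b => a.eval M - b.eval M
  | .mul a b => a.eval M * b.eval M
  | .div a b => a.eval M / b.eval M

/-- Truth of a test. -/
def Test.Holds (M : Mem) : Test → Prop
  | .ile a b => a.eval M ≤ b.eval M
  | .rle a b => a.eval M ≤ b.eval M
  | .neg p => ¬ p.Holds M
  | .conj p q => p.Holds M ∧ q.Holds M

/-- Time to evaluate an integer expression: the number of its nodes. -/
def IExpr.cost : IExpr → ℕ
  | .const _ => 1
  | .load a => a.cost + 1
  | .add a b => a.cost + b.cost + 1
  | .sub a b => a.cost + b.cost + 1
  | .mul a b => a.cost + b.cost + 1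

/-- Time to evaluate a real expression: the number of its nodes. -/
def RExpr.cost : RExpr → ℕ
  | .const _ => 1
  | .load a => a.cost + 1
  | .add a b => a.cost + b.cost + 1
  | .sub a b => a.cost + b.cost + 1
  | .mul a b => a.cost + b.cost + 1
  | .div a b => a.cost + b.cost + 1

/-- Time to evaluate a test: the number of its nodes. -/
def Test.cost : Test → ℕ
  | .ile a b => a.cost + b.cost + 1
  | .rle a b => a.cost + b.cost + 1
  | .neg p => p.cost + 1
  | .conj p q => p.cost + q.cost + 1

/-- Write `v` into the integer cell `a`. -/
def Mem.setInt (M : Mem) (a v : ℕ) : Mem := { M with int := Function.update M.int a v }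

/-- Write `v` into the real cell `a`. -/
def Mem.setReal (M : Mem) (a : ℕ) (v : ℝ) : Mem := { M with real := Function.update M.real a v }

/-- A configuration: the stack of programs that remain to be executed, and the memory.
The machine has halted when the stack is empty. -/
abbrev Config : Type := List Prog × Mem

open Classical in
/-- One transition. The instruction `rand addr bound` draws an integer uniformly from
`{0, …, bound}`, independently of everything before, and writes it into an integer cell. -/
def step : Config → PMF Config
  | ([], M) => PMF.pure ([], M)
  | (.skip :: K, M) => PMF.pure (K, M)
  | (.istore a e :: K, M) => PMF.pure (K, M.setInt (a.eval M) (e.eval M))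
  | (.rstore a e :: K, M) => PMF.pure (K, M.setReal (a.eval M) (e.eval M))
  | (.rand a b :: K, M) =>
      (PMF.uniformOfFintype (Fin (b.eval M + 1))).map fun v => (K, M.setInt (a.eval M) v)
  | (.seq p q :: K, M) => PMF.pure (p :: q :: K, M)
  | (.ite b p q :: K, M) => PMF.pure (if b.Holds M then (p :: K, M) else (q :: K, M))
  | (.loop b p :: K, M) => PMF.pure (if b.Holds M then (p :: .loop b p :: K, M) else (K, M))

/-- Time taken by the next transition: `1` plus the time to evaluate its expressions. -/
def stepCost : Config → ℕ
  | ([], _) => 0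
  | (.skip :: _, _) => 1
  | (.istore a e :: _, _) => a.cost + e.cost + 1
  | (.rstore a e :: _, _) => a.cost + e.cost + 1
  | (.rand a b :: _, _) => a.cost + b.cost + 1
  | (.seq _ _ :: _, _) => 1
  | (.ite b _ _ :: _, _) => b.cost + 1
  | (.loop b _ :: _, _) => b.cost + 1

/-- The law of the configuration reached after `t` transitions. -/
def run : ℕ → Config → PMF Config
  | 0, c => PMF.pure c
  | t + 1, c => (step c).bind (run t)

/-- The expected running time of the program `P` on the initial memory `M`: the sum, over all
`t`, of the expected time of the transition number `t`. -/
def expectedTime (P : Prog) (M : Mem) : ℝ≥0∞ :=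
  ∑' t : ℕ, ∑' c : Config, run t ([P], M) c * (stepCost c : ℝ≥0∞)

/-- The probability that `P`, started on the memory `M`, halts with a memory in `Post`. -/
def haltProb (P : Prog) (M : Mem) (Post : Set Mem) : ℝ≥0∞ :=
  ⨆ t : ℕ, (run t ([P], M)).toOuterMeasure {c | c.1 = [] ∧ c.2 ∈ Post}

/-- The memory `M` holds the polynomial `p`, given by the list of its terms in some order, without
repetition: integer cell `0` holds the number of variables `n`, integer cell `1` the number of
terms, and the real cells from `i * (n + 1)` on hold the coefficient and then the `n` exponents of
the `i`-th term. All other cells are arbitrary. (Coefficients on the support are finite.) -/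
def Stores {n : ℕ} (M : Mem) (p : MvPolynomial (Fin n) TropPoly.𝕋) : Prop :=
  M.int 0 = n ∧ M.int 1 = p.support.card ∧
  ∃ e : Fin p.support.card ≃ p.support, ∀ i : Fin p.support.card,
    M.real (i * (n + 1)) = (Tropical.untrop (p.coeff (e i))).toReal ∧
    ∀ j : Fin n, M.real (i * (n + 1) + 1 + j) = ((e i : Fin n →₀ ℕ) j : ℝ)

end RealRAM

end

/-!
A point `μ` of the support is a vertex of the Newton polytope if and only if the strict system
`0 < w ⬝ᵥ (ν - μ)`, where `ν` runs through the other points of the support, has a solution `w`.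

A strict homogeneous system is solved by adding its constraints one at a time. A solution `w` of the
first `i` constraints that violates the next constraint `p` is replaced: since the segment from `w`
to any solution of the extended system meets the hyperplane orthogonal to `p`, it suffices to solve
the constraints projected to that hyperplane, and to move the solution a little towards `p`. In a
plane, the solutions can be sought on one line, where the constraints are bounds from below and
above, so that time linear in the number `m` of constraints suffices. In dimension `d ≥ 2` the time
is then `O(m ^ (d - 1))`, even if every constraint is violated when its turn comes: no random order
of the constraints is needed. One such system for each of the `N` points of the support gives
`O(N ^ max 2 n)` vector operations, and comparing the vertices pairwise takes `O(N ^ 2)` more.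
-/

/-! ### Vertices of polytopes and separating functionals -/

section Separation

variable {E : Type*} [AddCommGroup E] [Module ℝ E] {S : Set E} {x : E}

theorem lt_of_mem_convexHull {f : E →ₗ[ℝ] ℝ} (hf : ∀ y ∈ S, y ≠ x → f x < f y) {y : E}
    (hy : y ∈ convexHull ℝ S) (hyx : y ≠ x) : f x < f y := by
  have hS : S ⊆ insert x (S \ {x}) := by simp
  have hy : y ∈ convexHull ℝ (insert x (S \ {x})) := convexHull_mono hS hy
  rcases (S \ {x}).eq_empty_or_nonempty with hempty | hne
  · simp [hempty, hyx] at hy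
  simp only [convexHull_insert hne, mem_convexJoin, Set.mem_singleton_iff, exists_eq_left] at hy
  obtain ⟨z, hz, a, b, ha, hb, hab, rfl⟩ := hy
  have hfz : f x < f z := convexHull_min (fun v hv => hf v hv.1 hv.2)
    (convex_halfSpace_gt f.isLinear (f x)) hz
  have hb : 0 < b := hb.lt_of_ne' (by rintro rfl; exact hyx (by simp_all))
  obtain rfl : a = 1 - b := by linarith
  simp only [map_add, map_smul, smul_eq_mul]
  nlinarith

theorem mem_extremePoints_convexHull_of_lt {f : E →ₗ[ℝ] ℝ} (hx : x ∈ S)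
    (hf : ∀ y ∈ S, y ≠ x → f x < f y) : x ∈ (convexHull ℝ S).extremePoints ℝ := by
  rw [(convex_convexHull ℝ S).mem_extremePoints_iff_mem_sdiff_convexHull_sdiff]
  refine ⟨subset_convexHull ℝ S hx, fun hmem => (lt_irrefl (f x)) ?_⟩
  exact convexHull_min (fun y hy => lt_of_mem_convexHull hf hy.1 hy.2)
    (convex_halfSpace_gt f.isLinear (f x)) hmem

theorem exists_lt_of_mem_extremePoints_convexHull [TopologicalSpace E] [IsTopologicalAddGroup E]
    [ContinuousSMul ℝ E] [LocallyConvexSpace ℝ E] [T2Space E] (hS : S.Finite)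
    (hx : x ∈ (convexHull ℝ S).extremePoints ℝ) :
    ∃ f : E →ₗ[ℝ] ℝ, ∀ y ∈ S, y ≠ x → f x < f y := by
  rw [(convex_convexHull ℝ S).mem_extremePoints_iff_mem_sdiff_convexHull_sdiff] at hx
  have hxS : x ∉ convexHull ℝ (S \ {x}) := fun hmem =>
    hx.2 (convexHull_mono (Set.sdiff_subset_sdiff_left (subset_convexHull ℝ S)) hmem)
  obtain ⟨f, u, hfx, hf⟩ := geometric_hahn_banach_point_closed (convex_convexHull ℝ _)
    ((hS.subset Set.sdiff_subset).isClosed_convexHull ℝ) hxS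
  exact ⟨f, fun y hy hyx => hfx.trans (hf y (subset_convexHull ℝ _ ⟨hy, hyx⟩))⟩

end Separation

namespace TropPoly

variable {n : ℕ}

theorem toPoint_injective : Function.Injective (toPoint (n := n)) := fun μ ν h => by
  ext j
  exact Nat.cast_injective (R := ℝ) (congrFun h j)

theorem vertNP_subset_support (s : MvPolynomial (Fin n) 𝕋) : vertNP s ⊆ s.support := fun μ hμ => by
  obtain ⟨ν, hν, h⟩ := extremePoints_convexHull_subset hμ
  rwa [← toPoint_injective h]

theorem vertNPmin_subset_support (s : MvPolynomial (Fin n) 𝕋) : vertNPmin s ⊆ s.support :=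
  fun _ hμ => vertNP_subset_support s (Minimal.prop hμ)

theorem mem_vertNP_iff {s : MvPolynomial (Fin n) 𝕋} {μ : Fin n →₀ ℕ} (hμ : μ ∈ s.support) :
    μ ∈ vertNP s ↔
      ∃ w : Fin n → ℝ, ∀ ν ∈ s.support, ν ≠ μ → 0 < w ⬝ᵥ (toPoint ν - toPoint μ) := by
  simp only [dotProduct_sub, sub_pos]
  constructor
  · intro h
    obtain ⟨f, hf⟩ := exists_lt_of_mem_extremePoints_convexHull
      (s.support.finite_toSet.image toPoint) h
    refine ⟨(dotProductEquiv ℝ (Fin n)).symm f, fun ν hν hne => ?_⟩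
    simp only [← dotProductEquiv_apply_apply, LinearEquiv.apply_symm_apply]
    exact hf _ (Set.mem_image_of_mem _ hν) (toPoint_injective.ne hne)
  · rintro ⟨w, hw⟩
    refine mem_extremePoints_convexHull_of_lt (f := dotProductEquiv ℝ (Fin n) w)
      (Set.mem_image_of_mem _ hμ) ?_
    rintro _ ⟨ν, hν, rfl⟩ hne
    exact hw ν hν (ne_of_apply_ne _ hne)

open Classical in
theorem coeff_sMin (s : MvPolynomial (Fin n) 𝕋) (μ : Fin n →₀ ℕ) :
    (sMin s).coeff μ = if μ ∈ vertNPmin s then 1 else 0 := by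
  simp only [sMin, MvPolynomial.coeff_sum, MvPolynomial.coeff_monomial, Finset.sum_ite_eq',
    Finset.mem_filter]
  exact if_congr (and_iff_right_of_imp fun h => vertNPmin_subset_support s h) rfl rfl

theorem mem_support_sMin {s : MvPolynomial (Fin n) 𝕋} {μ : Fin n →₀ ℕ} :
    μ ∈ (sMin s).support ↔ μ ∈ vertNPmin s := by
  have one_ne_zero : (1 : 𝕋) ≠ 0 := fun h => by simpa using congrArg Tropical.untrop h
  rw [MvPolynomial.mem_support_iff, coeff_sMin]
  by_cases h : μ ∈ vertNPmin s <;> simp [h, one_ne_zero]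

theorem image_support_sMin (s : MvPolynomial (Fin n) 𝕋) :
    toPoint '' ((sMin s).support : Set (Fin n →₀ ℕ)) = (NPmin s).extremePoints ℝ := by
  have hsupport : ((sMin s).support : Set (Fin n →₀ ℕ)) = vertNPmin s :=
    Set.ext fun _ => mem_support_sMin
  rw [hsupport]
  refine Set.Subset.antisymm ?_ extremePoints_convexHull_subset
  rintro _ ⟨μ, hμ, rfl⟩
  have hsub : NPmin s ⊆ NP s := convexHull_mono (Set.image_mono (vertNPmin_subset_support s))
  exact inter_extremePoints_subset_extremePoints_of_subset hsub
    ⟨subset_convexHull ℝ _ ⟨μ, hμ, rfl⟩, (Minimal.prop hμ : μ ∈ vertNP s)⟩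

end TropPoly

/-! ### Strict systems of homogeneous linear inequalities -/

namespace StrictSystem

variable {ι : Type*} [Fintype ι]

/-- Feasibility of the strict homogeneous system `0 < w ⬝ᵥ a j`, `j < m`, in the unknown `w`. -/
def Feasible (a : ℕ → ι → ℝ) (m : ℕ) : Prop := ∃ w : ι → ℝ, ∀ j < m, 0 < w ⬝ᵥ a j

theorem Feasible.mono {a : ℕ → ι → ℝ} {m k : ℕ} (h : Feasible a m) (hk : k ≤ m) : Feasible a k :=
  h.imp fun _ hw j hj => hw j (hj.trans_le hk)

theorem not_feasible_of_eq_zero {a : ℕ → ι → ℝ} {m j : ℕ} (hj : j < m) (ha : a j = 0) :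
    ¬ Feasible a m := by
  rintro ⟨w, hw⟩
  simpa [ha] using hw j hj

/-- The component of `v` orthogonal to `p`; it is `v` if `p = 0`. -/
noncomputable def orthComp (v p : ι → ℝ) : ι → ℝ := v - (v ⬝ᵥ p / (p ⬝ᵥ p)) • p

theorem dotProduct_self_pos {p : ι → ℝ} (hp : p ≠ 0) : 0 < p ⬝ᵥ p := by
  simpa using Matrix.dotProduct_self_star_pos_iff.2 hp

theorem dotProduct_self_nonpos {p : ι → ℝ} : p ⬝ᵥ p ≤ 0 ↔ p = 0 :=
  ⟨fun h => by_contra fun hp => (dotProduct_self_pos hp).not_ge h, by rintro rfl; simp⟩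

theorem orthComp_dotProduct_self {v p : ι → ℝ} (hp : p ≠ 0) : orthComp v p ⬝ᵥ p = 0 := by
  have := (dotProduct_self_pos hp).ne'
  simp only [orthComp, sub_dotProduct, smul_dotProduct, smul_eq_mul]
  field_simp
  ring

theorem dotProduct_orthComp (w v p : ι → ℝ) : w ⬝ᵥ orthComp v p = orthComp w p ⬝ᵥ v := by
  simp only [orthComp, sub_dotProduct, smul_dotProduct, dotProduct_sub, dotProduct_smul,
    smul_eq_mul, dotProduct_comm v p]
  ring

-- If `w` violates constraint `i` and `v` does not, some point of the segment `[v, w]` satisfies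
-- constraint `i` with equality, and the earlier constraints strictly.
theorem Feasible.project {a : ℕ → ι → ℝ} {i : ℕ} {w : ι → ℝ} (h : Feasible a (i + 1))
    (hw : ∀ j < i, 0 < w ⬝ᵥ a j) (hi : ¬ 0 < w ⬝ᵥ a i) :
    Feasible (fun j => orthComp (a j) (a i)) i := by
  obtain ⟨v, hv⟩ := h
  have hvi := hv i i.lt_succ_self
  set u := (-(w ⬝ᵥ a i)) • v + (v ⬝ᵥ a i) • w with hu
  have hui : u ⬝ᵥ a i = 0 := by
    simp only [hu, add_dotProduct, smul_dotProduct, smul_eq_mul]; ring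
  have huj : ∀ j < i, 0 < u ⬝ᵥ a j := fun j hj => by
    have hvj := hv j (by omega)
    simp only [hu, add_dotProduct, smul_dotProduct, smul_eq_mul]
    exact add_pos_of_nonneg_of_pos (mul_nonneg (by linarith) hvj.le) (mul_pos hvi (hw j hj))
  exact ⟨u, fun j hj => by
    simpa only [orthComp, dotProduct_sub, dotProduct_smul, hui, smul_zero, sub_zero]
      using huj j hj⟩

theorem exists_lift {a : ℕ → ι → ℝ} {i : ℕ} {w : ι → ℝ} (hi : a i ≠ 0)
    (hw : ∀ j < i, 0 < w ⬝ᵥ orthComp (a j) (a i)) :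
    ∃ t : ℝ, ∀ j < i + 1, 0 < (orthComp w (a i) + t • a i) ⬝ᵥ a j := by
  simp only [add_dotProduct, smul_dotProduct, smul_eq_mul]
  have eventually_pos : ∀ᶠ t : ℝ in nhdsWithin 0 (Set.Ioi 0), ∀ j ∈ Finset.range (i + 1),
      0 < orthComp w (a i) ⬝ᵥ a j + t * (a i ⬝ᵥ a j) := by
    rw [Filter.eventually_all_finset]
    intro j hj
    rcases Nat.lt_succ_iff_lt_or_eq.1 (Finset.mem_range.1 hj) with hj | rfl
    · have h := hw j hj
      rw [dotProduct_orthComp] at h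
      have hcont : Continuous fun t : ℝ => orthComp w (a i) ⬝ᵥ a j + t * (a i ⬝ᵥ a j) := by
        fun_prop
      exact nhdsWithin_le_nhds
        (continuousAt_const.eventually_lt hcont.continuousAt (x₀ := (0 : ℝ)) (by simpa using h))
    · filter_upwards [self_mem_nhdsWithin] with t ht
      rw [orthComp_dotProduct_self hi, zero_add]
      exact mul_pos ht (dotProduct_self_pos hi)
  obtain ⟨t, ht⟩ := eventually_pos.exists
  exact ⟨t, fun j hj => ht j (Finset.mem_range.2 hj)⟩

open Classical in
/-- The hyperplane orthogonal to `p`. -/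
noncomputable def orthSpace (p : ι → ℝ) : Submodule ℝ (ι → ℝ) :=
  LinearMap.ker (dotProductEquiv ℝ ι p)

theorem mem_orthSpace {p v : ι → ℝ} : v ∈ orthSpace p ↔ v ⬝ᵥ p = 0 := by
  rw [orthSpace, LinearMap.mem_ker, dotProductEquiv_apply_apply, dotProduct_comm]

theorem finrank_inf_orthSpace_le {V : Submodule ℝ (ι → ℝ)} {d : ℕ} {p : ι → ℝ}
    (hV : Module.finrank ℝ V ≤ d + 1) (hp : p ≠ 0) (hpV : p ∈ V) :
    Module.finrank ℝ (V ⊓ orthSpace p : Submodule ℝ (ι → ℝ)) ≤ d := by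
  have hlt : V ⊓ orthSpace p < V := by
    refine lt_of_le_of_ne inf_le_left fun h => ?_
    rw [← h] at hpV
    exact (dotProduct_self_pos hp).ne' (mem_orthSpace.1 hpV.2)
  have := Submodule.finrank_lt_finrank_of_lt hlt
  omega

theorem orthComp_mem_inf_orthSpace {V : Submodule ℝ (ι → ℝ)} {v p : ι → ℝ} (hp : p ≠ 0)
    (hpV : p ∈ V) (hv : v ∈ V) : orthComp v p ∈ V ⊓ orthSpace p :=
  ⟨V.sub_mem hv (V.smul_mem _ hpV), mem_orthSpace.2 (orthComp_dotProduct_self hp)⟩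

theorem exists_eq_smul_of_finrank_le_one {K E : Type*} [Field K] [AddCommGroup E] [Module K E]
    {V : Submodule K E} [Module.Finite K V] (hV : Module.finrank K V ≤ 1) {y z : E} (hy : y ≠ 0)
    (hyV : y ∈ V) (hzV : z ∈ V) : ∃ c : K, z = c • y := by
  have hyV0 : (⟨y, hyV⟩ : V) ≠ 0 := fun h => hy (congrArg Subtype.val h)
  have hV1 := hV.antisymm (Module.finrank_pos_iff_exists_ne_zero.2 ⟨_, hyV0⟩)
  obtain ⟨c, hc⟩ := exists_smul_eq_of_finrank_eq_one hV1 hyV0 ⟨z, hzV⟩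
  exact ⟨c, congrArg Subtype.val hc.symm⟩

/-- The vectors `a j`, `j < m`, lie in the plane of the orthogonal vectors `x` and `y`, and `x` is
the first of them. -/
structure InPlane (a : ℕ → ι → ℝ) (m : ℕ) (x y : ι → ℝ) : Prop where
  head : 0 < m → x = a 0
  orth : y ⬝ᵥ x = 0
  coord : ∀ j < m, ∃ c : ℝ, orthComp (a j) x = c • y

-- The line `x + ℝ y` meets every open half-plane containing `x`, after rescaling.
theorem Feasible.exists_line {a : ℕ → ι → ℝ} {m : ℕ} (h : Feasible a m) {x y : ι → ℝ}
    (hxy : InPlane a m x y) : ∃ t : ℝ, ∀ j < m, 0 < (x + t • y) ⬝ᵥ a j := by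
  obtain ⟨w, hw⟩ := h
  rcases Nat.eq_zero_or_pos m with rfl | hm
  · exact ⟨0, by simp⟩
  have hwx : 0 < w ⬝ᵥ x := by rw [hxy.head hm]; exact hw 0 hm
  have hxx : 0 < x ⬝ᵥ x := dotProduct_self_pos (by rintro rfl; simp at hwx)
  refine ⟨(x ⬝ᵥ x) * (w ⬝ᵥ y) / ((w ⬝ᵥ x) * (y ⬝ᵥ y)), fun j hj => ?_⟩
  obtain ⟨c, hc⟩ := hxy.coord j hj
  obtain ⟨r, hr⟩ : ∃ r, a j = r • x + c • y := ⟨_, by rw [← hc, orthComp, add_sub_cancel]⟩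
  have hwj := hw j hj
  rw [hr] at hwj ⊢
  simp only [dotProduct_add, dotProduct_smul, add_dotProduct, smul_dotProduct, smul_eq_mul,
    hxy.orth, dotProduct_comm x y, mul_zero, add_zero, zero_add] at hwj ⊢
  have key : r * (x ⬝ᵥ x) + c * ((x ⬝ᵥ x) * (w ⬝ᵥ y) / ((w ⬝ᵥ x) * (y ⬝ᵥ y)) * (y ⬝ᵥ y)) =
      (x ⬝ᵥ x) / (w ⬝ᵥ x) * (r * (w ⬝ᵥ x) + c * (w ⬝ᵥ y)) := by
    rcases eq_or_ne y 0 with rfl | hy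
    · simp only [dotProduct_zero]; field_simp
    · have := dotProduct_self_pos hy
      field_simp
  rw [key]
  positivity

/-- The vector `y` is a non-zero one of the `orthComp (a j) x`, `j < m`, or `0` if there is none. -/
def IsSecondAxis (a : ℕ → ι → ℝ) (m : ℕ) (x y : ι → ℝ) : Prop :=
  (y = 0 ∧ ∀ j < m, orthComp (a j) x = 0) ∨ (y ≠ 0 ∧ ∃ j < m, y = orthComp (a j) x)

theorem IsSecondAxis.inPlane {a : ℕ → ι → ℝ} {m : ℕ} {y : ι → ℝ} {V : Submodule ℝ (ι → ℝ)}
    (h : IsSecondAxis a m (a 0) y) (hV : Module.finrank ℝ V ≤ 2) (ha : ∀ j < m, a j ∈ V)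
    (hm : 0 < m) (h0 : a 0 ≠ 0) : InPlane a m (a 0) y where
  head _ := rfl
  orth := by
    rcases h with ⟨rfl, -⟩ | ⟨-, j, -, rfl⟩
    · exact zero_dotProduct _
    · exact orthComp_dotProduct_self h0
  coord j hj := by
    rcases h with ⟨rfl, hzero⟩ | ⟨hy, i, hi, rfl⟩
    · exact ⟨0, by rw [hzero j hj, zero_smul]⟩
    · exact exists_eq_smul_of_finrank_le_one (finrank_inf_orthSpace_le hV h0 (ha 0 hm)) hy
        (orthComp_mem_inf_orthSpace h0 (ha 0 hm) (ha i hi))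
        (orthComp_mem_inf_orthSpace h0 (ha 0 hm) (ha j hj))

end StrictSystem

namespace RealRAM

open StrictSystem TropPoly

/-! ### Big-step semantics of the deterministic instructions -/

/-- `Runs P M t M'`: the program `P`, started on `M`, halts on `M'` after time `t` without
drawing random numbers. -/
inductive Runs : Prog → Mem → ℕ → Mem → Prop
  | skip (M : Mem) : Runs .skip M 1 M
  | istore (a e : IExpr) (M : Mem) :
      Runs (.istore a e) M (a.cost + e.cost + 1) (M.setInt (a.eval M) (e.eval M))
  | rstore (a : IExpr) (e : RExpr) (M : Mem) :
      Runs (.rstore a e) M (a.cost + e.cost + 1) (M.setReal (a.eval M) (e.eval M))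
  | seq {p q : Prog} {M M' M'' : Mem} {t t' : ℕ} :
      Runs p M t M' → Runs q M' t' M'' → Runs (.seq p q) M (t + t' + 1) M''
  | ite_true {b : Test} {p q : Prog} {M M' : Mem} {t : ℕ} :
      b.Holds M → Runs p M t M' → Runs (.ite b p q) M (t + b.cost + 1) M'
  | ite_false {b : Test} {p q : Prog} {M M' : Mem} {t : ℕ} :
      ¬ b.Holds M → Runs q M t M' → Runs (.ite b p q) M (t + b.cost + 1) M'
  | loop_true {b : Test} {p : Prog} {M M' M'' : Mem} {t t' : ℕ} :
      b.Holds M → Runs p M t M' → Runs (.loop b p) M' t' M'' →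
        Runs (.loop b p) M (t + t' + b.cost + 1) M''
  | loop_false {b : Test} {p : Prog} {M : Mem} :
      ¬ b.Holds M → Runs (.loop b p) M (b.cost + 1) M

/-- The expected time spent from a configuration on. -/
noncomputable def timeFrom (c₀ : Config) : ℝ≥0∞ :=
  ∑' t : ℕ, ∑' c : Config, run t c₀ c * (stepCost c : ℝ≥0∞)

theorem tsum_pure_mul {α : Type*} (a : α) (f : α → ℝ≥0∞) : ∑' x, PMF.pure a x * f x = f a := by
  rw [tsum_eq_single a fun x hx => by simp [hx]]
  simp

theorem run_succ_of_step {c₀ c₁ : Config} (h : step c₀ = PMF.pure c₁) (t : ℕ) :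
    run (t + 1) c₀ = run t c₁ := by
  simp [run, h]

theorem timeFrom_of_step {c₀ c₁ : Config} (h : step c₀ = PMF.pure c₁) :
    timeFrom c₀ = stepCost c₀ + timeFrom c₁ := by
  unfold timeFrom
  rw [tsum_eq_zero_add' ENNReal.summable]
  congr 1
  · exact tsum_pure_mul c₀ _
  · simp only [run_succ_of_step h]

theorem run_nil (t : ℕ) (M : Mem) : run t ([], M) = PMF.pure ([], M) := by
  induction t with
  | zero => rfl
  | succ t ih => rw [run_succ_of_step (c₁ := ([], M)) rfl, ih]

theorem timeFrom_nil (M : Mem) : timeFrom ([], M) = 0 := by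
  simp [timeFrom, run_nil, stepCost]

/-- Finitely many deterministic transitions, taking time `t` in total, lead from `c₀` to `c₁`. -/
def Reaches (c₀ : Config) (t : ℕ) (c₁ : Config) : Prop :=
  (∃ T, ∀ r, run (r + T) c₀ = run r c₁) ∧ timeFrom c₀ = t + timeFrom c₁

theorem Reaches.trans {a b c : Config} {s t : ℕ} (h₁ : Reaches a s b) (h₂ : Reaches b t c) :
    Reaches a (s + t) c := by
  obtain ⟨⟨T₁, run₁⟩, time₁⟩ := h₁
  obtain ⟨⟨T₂, run₂⟩, time₂⟩ := h₂
  refine ⟨⟨T₂ + T₁, fun r => ?_⟩, ?_⟩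
  · rw [← add_assoc, run₁, run₂]
  · rw [time₁, time₂]; push_cast; ring

theorem Reaches.of_step {c₀ c₁ : Config} (h : step c₀ = PMF.pure c₁) :
    Reaches c₀ (stepCost c₀) c₁ :=
  ⟨⟨1, run_succ_of_step h⟩, timeFrom_of_step h⟩

theorem Reaches.head {a b c : Config} {s t : ℕ} (h : step a = PMF.pure b)
    (hbc : Reaches b s c) (ht : stepCost a + s = t := by simp only [stepCost]; ring) :
    Reaches a t c :=
  ht ▸ (Reaches.of_step h).trans hbc

theorem Runs.reaches {P : Prog} {M M' : Mem} {t : ℕ} (h : Runs P M t M') (K : List Prog) :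
    Reaches (P :: K, M) t (K, M') := by
  induction h generalizing K with
  | skip M => exact .of_step rfl
  | istore a e M => exact .of_step rfl
  | rstore a e M => exact .of_step rfl
  | seq _ _ ih₁ ih₂ => exact .head rfl ((ih₁ _).trans (ih₂ K))
  | ite_true hb _ ih => exact .head (by simp only [step, hb, if_true]) (ih K)
  | ite_false hb _ ih => exact .head (by simp only [step, hb, if_false]) (ih K)
  | loop_true hb _ _ ih₁ ih₂ =>
    exact .head (by simp only [step, hb, if_true]) ((ih₁ _).trans (ih₂ K))
  | loop_false hb => exact .of_step (by simp only [step, hb, if_false])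

theorem Runs.expectedTime_eq {P : Prog} {M M' : Mem} {t : ℕ} (h : Runs P M t M') :
    expectedTime P M = t := by
  have htime := (h.reaches []).2
  rwa [timeFrom_nil, add_zero] at htime

theorem Runs.haltProb_eq_one {P : Prog} {M M' : Mem} {t : ℕ} (h : Runs P M t M') {Post : Set Mem}
    (hM : M' ∈ Post) : haltProb P M Post = 1 := by
  obtain ⟨T, hT⟩ := (h.reaches []).1
  refine le_antisymm (iSup_le fun r => ?_) (le_iSup_of_le T ?_)
  · exact (MeasureTheory.measure_mono (Set.subset_univ _)).trans
      ((PMF.toOuterMeasure_apply_eq_one_iff _ _).2 (Set.subset_univ _)).le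
  · rw [← zero_add T, hT 0, run, PMF.toOuterMeasure_pure_apply, if_pos ⟨rfl, hM⟩]

/-! ### Counting loops -/

/-- The part of `forLoop` that follows the initialisation of the counter. -/
def countLoop (c : ℕ) (e : IExpr) (body : Prog) : Prog :=
  .loop (.neg (.ile e (.load (.const c))))
    (.seq body (.istore (.const c) (.add (.load (.const c)) (.const 1))))

/-- `for c := 0 to e - 1 do body`, with the counter in the integer cell `c`. -/
def forLoop (c : ℕ) (e : IExpr) (body : Prog) : Prog :=
  .seq (.istore (.const c) (.const 0)) (countLoop c e body)

/-- `Inv` is an invariant of the loop `for c := 0 to m - 1 do body`, where `e` evaluates to `m`, and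
each round of the body takes time at most `b`. -/
structure LoopInvariant (c : ℕ) (e : IExpr) (body : Prog) (m b : ℕ) (Inv : ℕ → Mem → Prop) :
    Prop where
  counter : ∀ k M, Inv k M → M.int c = k
  bound : ∀ k M, Inv k M → e.eval M = m
  body : ∀ k M, k < m → Inv k M → ∃ t M', Runs body M t M' ∧ t ≤ b ∧ M'.int c = k ∧
    Inv (k + 1) (M'.setInt c (k + 1))

theorem LoopInvariant.runs_countLoop {c : ℕ} {e : IExpr} {body : Prog} {m b : ℕ}
    {Inv : ℕ → Mem → Prop} (hInv : LoopInvariant c e body m b Inv) (d k : ℕ) (M : Mem)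
    (hk : k + d = m) (hM : Inv k M) :
    ∃ t M', Runs (countLoop c e body) M t M' ∧
      t ≤ d * (b + e.cost + 20) + e.cost + 10 ∧ Inv m M' := by
  have hcounter := hInv.counter k M hM
  have hbound := hInv.bound k M hM
  induction d generalizing k M with
  | zero =>
    refine ⟨_, M, Runs.loop_false ?_, ?_, hk ▸ hM⟩
    · simp only [Test.Holds, IExpr.eval, hcounter, hbound]; omega
    · simp only [Test.cost, IExpr.cost]; omega
  | succ d ih =>
    obtain ⟨t, M', hbody, ht, hc, hM'⟩ := hInv.body k M (by omega) hM
    obtain ⟨t', M'', hrest, ht', hM''⟩ := ih (k + 1) _ (by omega) hM' (hInv.counter _ _ hM')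
      (hInv.bound _ _ hM')
    refine ⟨_, M'', Runs.loop_true ?_ (hbody.seq (.istore _ _ _)) (t' := t') ?_, ?_, hM''⟩
    · simp only [Test.Holds, IExpr.eval, hcounter, hbound]; omega
    · simpa only [IExpr.eval, hc, countLoop] using hrest
    · simp only [Test.cost, IExpr.cost, add_mul, one_mul]; omega

theorem LoopInvariant.runs_forLoop {c : ℕ} {e : IExpr} {body : Prog} {m b : ℕ}
    {Inv : ℕ → Mem → Prop} (hInv : LoopInvariant c e body m b Inv) {M : Mem}
    (hM : Inv 0 (M.setInt c 0)) :
    ∃ t M', Runs (forLoop c e body) M t M' ∧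
      t ≤ m * (b + e.cost + 20) + e.cost + 20 ∧ Inv m M' := by
  obtain ⟨t, M', hloop, ht, hM'⟩ := hInv.runs_countLoop m 0 _ (zero_add m) hM
  refine ⟨_, M', .seq (.istore _ _ _) hloop, ?_, hM'⟩
  simp only [IExpr.cost]; omega

/-! ### The data of the algorithm and their place in the memory -/

/-- The sizes and the content of the input, which stay fixed during a run. -/
structure Layout where
  numVars : ℕ
  numTerms : ℕ
  input : ℕ → ℝ

namespace Layout

variable (L : Layout)

/-- The number of real cells that are occupied by the input. -/
def base : ℕ := L.numTerms * (L.numVars + 1)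

/-- The level on which a system of inequalities in `numVars` unknowns is solved. Level `l` is for
constraints that span a space of dimension at most `l`, and planes are treated directly. -/
def topLevel : ℕ := max 2 L.numVars

/-- The exponent vector of the `p`-th term of the input. -/
def point (p : ℕ) (k : Fin L.numVars) : ℝ := L.input (p * (L.numVars + 1) + 1 + k)

end Layout

/-- The integer registers of the algorithm. -/
inductive Reg
  | point
  | level
  | status
  | count
  | iter
  | hasLower
  | hasUpper
  | isMinimal
  | dominates
  deriving DecidableEq

/-- The real registers of the algorithm. -/
inductive Scalar
  | fst
  | snd
  | lower
  | upper
  | param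
  deriving DecidableEq

def Reg.code : Reg → ℕ
  | .point => 0
  | .level => 1
  | .status => 2
  | .count => 3
  | .iter => 4
  | .hasLower => 5
  | .hasUpper => 6
  | .isMinimal => 7
  | .dominates => 8

def Scalar.code : Scalar → ℕ
  | .fst => 0
  | .snd => 1
  | .lower => 2
  | .upper => 3
  | .param => 4

theorem Reg.code_injective : Function.Injective Reg.code := by
  intro r s h
  cases r <;> cases s <;> first | rfl | cases h

theorem Scalar.code_injective : Function.Injective Scalar.code := by
  intro r s h
  cases r <;> cases s <;> first | rfl | cases h

/-- The integer variables of the algorithm: the registers, for each level a cursor that counts the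
constraints treated so far, and for each input point a flag. -/
inductive Cell
  | reg (r : Reg)
  | cursor (l : ℕ)
  | flag (p : ℕ)

/-- The integer cells below `8` are kept for the sizes of the input and for hidden counters. -/
def Cell.address : Cell → ℕ
  | .reg r => 8 + 3 * r.code
  | .cursor l => 9 + 3 * l
  | .flag p => 10 + 3 * p

theorem Cell.le_address (c : Cell) : 8 ≤ c.address := by
  cases c <;> simp only [Cell.address] <;> omega

theorem Cell.address_injective : Function.Injective Cell.address := by
  intro c c' h
  cases c <;> cases c' <;> simp only [Cell.address] at h <;> try omega
  · exact congrArg _ (Reg.code_injective (by omega))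
  · exact congrArg _ (by omega)
  · exact congrArg _ (by omega)

/-- The values of the variables of the algorithm. The vectors are indexed by a level and a row: the
rows `j + 1` of a level hold its constraints and the row `0` holds the current solution. The level
`0` is a scratch area. -/
structure State (L : Layout) where
  reg : Reg → ℕ
  cursor : ℕ → ℕ
  flag : ℕ → ℕ
  scalar : Scalar → ℝ
  vec : ℕ → ℕ → Fin L.numVars → ℝ

variable {L : Layout}

namespace State

@[simps -fullyApplied]
def setReg (σ : State L) (r : Reg) (v : ℕ) : State L := { σ with reg := Function.update σ.reg r v }

@[simps -fullyApplied]
def setCursor (σ : State L) (l v : ℕ) : State L :=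
  { σ with cursor := Function.update σ.cursor l v }

@[simps -fullyApplied]
def setFlag (σ : State L) (p v : ℕ) : State L := { σ with flag := Function.update σ.flag p v }

@[simps -fullyApplied]
def setScalar (σ : State L) (s : Scalar) (v : ℝ) : State L :=
  { σ with scalar := Function.update σ.scalar s v }

@[simps -fullyApplied]
def setVec (σ : State L) (l i : ℕ) (v : Fin L.numVars → ℝ) : State L :=
  { σ with vec := fun l' i' => if l' = l ∧ i' = i then v else σ.vec l' i' }

def get (σ : State L) : Cell → ℕ
  | .reg r => σ.reg r
  | .cursor l => σ.cursor l
  | .flag p => σ.flag p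

def set (σ : State L) : Cell → ℕ → State L
  | .reg r => σ.setReg r
  | .cursor l => σ.setCursor l
  | .flag p => σ.setFlag p

theorem get_set_self (σ : State L) (c : Cell) (v : ℕ) : (σ.set c v).get c = v := by
  cases c <;> simp [get, set]

theorem get_set_of_ne (σ : State L) {c c' : Cell} (h : c' ≠ c) (v : ℕ) :
    (σ.set c v).get c' = σ.get c' := by
  cases c <;> cases c' <;> simp_all [get, set]

theorem scalar_set (σ : State L) (c : Cell) (v : ℕ) : (σ.set c v).scalar = σ.scalar := by
  cases c <;> rfl

theorem vec_set (σ : State L) (c : Cell) (v : ℕ) : (σ.set c v).vec = σ.vec := by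
  cases c <;> rfl

theorem setVec_vec_self (σ : State L) (l i : ℕ) : σ.setVec l i (σ.vec l i) = σ := by
  obtain ⟨reg, cursor, flag, scalar, vec⟩ := σ
  simp only [setVec, mk.injEq, true_and]
  grind

theorem setVec_setVec (σ : State L) (l i : ℕ) (u v : Fin L.numVars → ℝ) :
    (σ.setVec l i u).setVec l i v = σ.setVec l i v := by
  simp only [setVec, mk.injEq, true_and]
  grind

end State

/-- An injection of `ℕ × ℕ` into `ℕ` that the machine can compute. -/
def pairCode (l i : ℕ) : ℕ := (l + i) * (l + i) + i

theorem pairCode_inj {l i l' i' : ℕ} : pairCode l i = pairCode l' i' ↔ l = l' ∧ i = i' := by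
  refine ⟨fun h => ?_, fun ⟨hl, hi⟩ => hl ▸ hi ▸ rfl⟩
  unfold pairCode at h
  rcases lt_trichotomy (l + i) (l' + i') with hlt | heq | hlt
  · nlinarith
  · rw [heq] at h; omega
  · nlinarith

namespace Layout

variable (L)

/-- The scalars are in the even cells and the vectors in the odd cells of the real memory, counted
from `base` on; the cell `base` itself is a hidden accumulator. -/
def scalarAddress (s : Scalar) : ℕ := L.base + 2 * (s.code + 1)

/-- The real cell of the coordinate `k` of the vector `(l, i)`. -/
def vecAddress (l i k : ℕ) : ℕ := L.base + 1 + 2 * (pairCode l i * L.numVars + k)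

variable {L}

theorem scalarAddress_injective : Function.Injective L.scalarAddress := fun s s' h =>
  Scalar.code_injective (by unfold scalarAddress at h; omega)

theorem vecAddress_inj {l i l' i' : ℕ} {k k' : Fin L.numVars} :
    L.vecAddress l i k = L.vecAddress l' i' k' ↔ (l' = l ∧ i' = i) ∧ k' = k := by
  refine ⟨fun h => ?_, fun ⟨⟨hl, hi⟩, hk⟩ => by rw [hl, hi, hk]⟩
  have hcode : pairCode l i * L.numVars + k = pairCode l' i' * L.numVars + k' := by
    unfold vecAddress at h; omega
  have hk : (k : ℕ) = k' := by
    have := congrArg (· % L.numVars) hcode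
    simpa [Nat.add_mod, Nat.mod_eq_of_lt] using this
  have hpair : pairCode l' i' = pairCode l i :=
    Nat.eq_of_mul_eq_mul_right (Fin.pos k) (by omega)
  exact ⟨pairCode_inj.1 hpair, Fin.ext hk.symm⟩

end Layout

/-- The memory `M` holds the input and the values `σ` of the variables. -/
structure Represents (M : Mem) (σ : State L) : Prop where
  numVars : M.int 0 = L.numVars
  numTerms : M.int 1 = L.numTerms
  base : M.int 2 = L.base
  topLevel : M.int 3 = L.topLevel
  cell : ∀ c : Cell, M.int c.address = σ.get c
  input : ∀ a < L.base, M.real a = L.input a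
  scalar : ∀ s, M.real (L.scalarAddress s) = σ.scalar s
  vec : ∀ l i (k : Fin L.numVars), M.real (L.vecAddress l i k) = σ.vec l i k

namespace Represents

variable {M : Mem} {σ : State L}

theorem setInt (h : Represents M σ) (c : Cell) (v : ℕ) :
    Represents (M.setInt c.address v) (σ.set c v) where
  numVars := by simp [Mem.setInt, h.numVars, show 0 ≠ c.address from by have := c.le_address; omega]
  numTerms := by
    simp [Mem.setInt, h.numTerms, show 1 ≠ c.address from by have := c.le_address; omega]
  base := by simp [Mem.setInt, h.base, show 2 ≠ c.address from by have := c.le_address; omega]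
  topLevel := by
    simp [Mem.setInt, h.topLevel, show 3 ≠ c.address from by have := c.le_address; omega]
  cell c' := by
    by_cases hc : c' = c
    · simp [Mem.setInt, hc, State.get_set_self]
    · rw [State.get_set_of_ne σ hc, ← h.cell c']
      exact Function.update_of_ne (Cell.address_injective.ne hc) _ _
  input := h.input
  scalar s := by rw [State.scalar_set]; exact h.scalar s
  vec l i k := by rw [State.vec_set]; exact h.vec l i k

theorem setInt_of_hidden (h : Represents M σ) {a : ℕ} (ha : 4 ≤ a) (ha' : a < 8) (v : ℕ) :
    Represents (M.setInt a v) σ where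
  numVars := by simp [Mem.setInt, h.numVars, show 0 ≠ a by omega]
  numTerms := by simp [Mem.setInt, h.numTerms, show 1 ≠ a by omega]
  base := by simp [Mem.setInt, h.base, show 2 ≠ a by omega]
  topLevel := by simp [Mem.setInt, h.topLevel, show 3 ≠ a by omega]
  cell c := by
    rw [← h.cell c]
    exact Function.update_of_ne (by have := c.le_address; omega) _ _
  input := h.input
  scalar := h.scalar
  vec := h.vec

theorem setReal_base (h : Represents M σ) (v : ℝ) : Represents (M.setReal L.base v) σ where
  numVars := h.numVars
  numTerms := h.numTerms
  base := h.base
  topLevel := h.topLevel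
  cell := h.cell
  input a ha := by simp [Mem.setReal, h.input a ha, ha.ne]
  scalar s := by
    rw [← h.scalar s]
    exact Function.update_of_ne (by unfold Layout.scalarAddress; omega) _ _
  vec l i k := by
    rw [← h.vec l i k]
    exact Function.update_of_ne (by unfold Layout.vecAddress; omega) _ _

theorem setScalar (h : Represents M σ) (s : Scalar) (v : ℝ) :
    Represents (M.setReal (L.scalarAddress s) v) (σ.setScalar s v) where
  numVars := h.numVars
  numTerms := h.numTerms
  base := h.base
  topLevel := h.topLevel
  cell := h.cell
  input a ha := by
    rw [← h.input a ha]
    exact Function.update_of_ne (by unfold Layout.scalarAddress; omega) _ _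
  scalar s' := by
    simp only [Mem.setReal, State.setScalar_scalar, Function.update_apply, h.scalar,
      Layout.scalarAddress_injective.eq_iff]
  vec l i k := by
    rw [State.setScalar_vec, ← h.vec l i k]
    exact Function.update_of_ne (by unfold Layout.scalarAddress Layout.vecAddress; omega) _ _

theorem setCoord (h : Represents M σ) (l i : ℕ) (k : Fin L.numVars) (v : ℝ) :
    Represents (M.setReal (L.vecAddress l i k) v)
      (σ.setVec l i (Function.update (σ.vec l i) k v)) where
  numVars := h.numVars
  numTerms := h.numTerms
  base := h.base
  topLevel := h.topLevel
  cell := h.cell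
  input a ha := by
    rw [← h.input a ha]
    exact Function.update_of_ne (by unfold Layout.vecAddress; omega) _ _
  scalar s := by
    rw [State.setVec_scalar, ← h.scalar s]
    exact Function.update_of_ne (by unfold Layout.scalarAddress Layout.vecAddress; omega) _ _
  vec l' i' k' := by
    simp only [Mem.setReal, State.setVec_vec, Function.update_apply, Layout.vecAddress_inj, h.vec]
    grind

end Represents

/-! ### Expressions over the variables of the algorithm -/

/-- Integer expressions over the variables of the algorithm. -/
inductive IntTerm
  | const (k : ℕ)
  | numVars
  | numTerms
  | topLevel
  | reg (r : Reg)
  | cursor (l : IntTerm)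
  | flag (p : IntTerm)
  | add (a b : IntTerm)
  | sub (a b : IntTerm)

/-- Scalar expressions over the variables of the algorithm. -/
inductive RealTerm
  | const (k : ℤ)
  | scalar (s : Scalar)
  | add (a b : RealTerm)
  | sub (a b : RealTerm)
  | div (a b : RealTerm)

/-- Vector expressions over the variables of the algorithm. -/
inductive VecTerm
  | zero
  | vec (l i : IntTerm)
  | point (p : IntTerm)
  | add (u v : VecTerm)
  | sub (u v : VecTerm)
  | smul (a : RealTerm) (v : VecTerm)

/-- Conditions on the variables of the algorithm. -/
inductive Cond
  | ile (a b : IntTerm)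
  | rle (a b : RealTerm)
  | not (p : Cond)
  | and (p q : Cond)

/-- The value of an integer expression. -/
def IntTerm.value (σ : State L) : IntTerm → ℕ
  | .const k => k
  | .numVars => L.numVars
  | .numTerms => L.numTerms
  | .topLevel => L.topLevel
  | .reg r => σ.reg r
  | .cursor l => σ.cursor (l.value σ)
  | .flag p => σ.flag (p.value σ)
  | .add a b => a.value σ + b.value σ
  | .sub a b => a.value σ - b.value σ

/-- The value of a scalar expression. -/
noncomputable def RealTerm.value (σ : State L) : RealTerm → ℝ
  | .const k => k
  | .scalar s => σ.scalar s
  | .add a b => a.value σ + b.value σ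
  | .sub a b => a.value σ - b.value σ
  | .div a b => a.value σ / b.value σ

/-- The value of a vector expression. -/
noncomputable def VecTerm.value (σ : State L) : VecTerm → Fin L.numVars → ℝ
  | .zero => 0
  | .vec l i => σ.vec (l.value σ) (i.value σ)
  | .point p => L.point (p.value σ)
  | .add u v => u.value σ + v.value σ
  | .sub u v => u.value σ - v.value σ
  | .smul a v => a.value σ • v.value σ

/-- The input points in a vector expression exist. -/
def VecTerm.Valid (σ : State L) : VecTerm → Prop
  | .zero => True
  | .vec _ _ => True
  | .point p => p.value σ < L.numTerms
  | .add u v => u.Valid σ ∧ v.Valid σ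
  | .sub u v => u.Valid σ ∧ v.Valid σ
  | .smul _ v => v.Valid σ

/-- The truth of a condition. -/
def Cond.Holds (σ : State L) : Cond → Prop
  | .ile a b => a.value σ ≤ b.value σ
  | .rle a b => a.value σ ≤ b.value σ
  | .not p => ¬ p.Holds σ
  | .and p q => p.Holds σ ∧ q.Holds σ

def cursorAddress (l : IExpr) : IExpr := .add (.const 9) (.mul (.const 3) l)

def flagAddress (p : IExpr) : IExpr := .add (.const 10) (.mul (.const 3) p)

/-- Translation of an integer expression. -/
def IntTerm.compile : IntTerm → IExpr
  | .const k => .const k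
  | .numVars => .load (.const 0)
  | .numTerms => .load (.const 1)
  | .topLevel => .load (.const 3)
  | .reg r => .load (.const (8 + 3 * r.code))
  | .cursor l => .load (cursorAddress l.compile)
  | .flag p => .load (flagAddress p.compile)
  | .add a b => .add a.compile b.compile
  | .sub a b => .sub a.compile b.compile

def scalarAddress (s : Scalar) : IExpr :=
  .add (.load (.const 2)) (.const (2 * (s.code + 1)))

/-- The address of the coordinate of the vector `(l, i)` whose number is in the integer cell `4`. -/
def vecAddress (l i : IntTerm) : IExpr :=
  let s : IExpr := .add l.compile i.compile
  let code : IExpr := .add (.mul s s) i.compile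
  .add (.add (.load (.const 2)) (.const 1))
    (.mul (.const 2) (.add (.mul code (.load (.const 0))) (.load (.const 4))))

/-- Translation of a scalar expression. -/
def RealTerm.compile : RealTerm → RExpr
  | .const k => .const k
  | .scalar s => .load (scalarAddress s)
  | .add a b => .add a.compile b.compile
  | .sub a b => .sub a.compile b.compile
  | .div a b => .div a.compile b.compile

/-- Translation of the coordinate of a vector expression whose number is in the integer cell `4`. -/
def VecTerm.compile : VecTerm → RExpr
  | .zero => .const 0
  | .vec l i => .load (vecAddress l i)
  | .point p => .load (.add (.add (.mul p.compile (.add (.load (.const 0)) (.const 1))) (.const 1))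
      (.load (.const 4)))
  | .add u v => .add u.compile v.compile
  | .sub u v => .sub u.compile v.compile
  | .smul a v => .mul a.compile v.compile

/-- Translation of a condition. -/
def Cond.compile : Cond → Test
  | .ile a b => .ile a.compile b.compile
  | .rle a b => .rle a.compile b.compile
  | .not p => .neg p.compile
  | .and p q => .conj p.compile q.compile

namespace Represents

variable {M : Mem} {σ : State L}

theorem eval_intTerm (h : Represents M σ) (e : IntTerm) : e.compile.eval M = e.value σ := by
  induction e with
  | const k => rfl
  | numVars => exact h.numVars
  | numTerms => exact h.numTerms
  | topLevel => exact h.topLevel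
  | reg r => exact h.cell (.reg r)
  | cursor l ih => rw [IntTerm.value, ← ih]; exact h.cell (.cursor _)
  | flag p ih => rw [IntTerm.value, ← ih]; exact h.cell (.flag _)
  | add a b iha ihb => exact congrArg₂ _ iha ihb
  | sub a b iha ihb => exact congrArg₂ _ iha ihb

theorem eval_scalarAddress (h : Represents M σ) (s : Scalar) :
    (scalarAddress s).eval M = L.scalarAddress s := by
  simp only [scalarAddress, IExpr.eval, h.base, Layout.scalarAddress]

theorem eval_vecAddress (h : Represents M σ) (l i : IntTerm) :
    (vecAddress l i).eval M = L.vecAddress (l.value σ) (i.value σ) (M.int 4) := by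
  simp only [vecAddress, IExpr.eval, h.base, h.numVars, h.eval_intTerm, Layout.vecAddress, pairCode]

theorem eval_realTerm (h : Represents M σ) (e : RealTerm) : e.compile.eval M = e.value σ := by
  induction e with
  | const k => rfl
  | scalar s => rw [RealTerm.compile, RExpr.eval, h.eval_scalarAddress, h.scalar, RealTerm.value]
  | add a b iha ihb => exact congrArg₂ _ iha ihb
  | sub a b iha ihb => exact congrArg₂ _ iha ihb
  | div a b iha ihb => exact congrArg₂ _ iha ihb

theorem real_point (h : Represents M σ) {p : ℕ} (hp : p < L.numTerms) (k : Fin L.numVars) :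
    M.real (p * (L.numVars + 1) + 1 + k) = L.point p k := by
  refine h.input _ (lt_of_lt_of_le ?_ (Nat.mul_le_mul_right _ (Nat.succ_le_of_lt hp)))
  rw [Nat.succ_mul]
  omega

theorem eval_vecTerm (h : Represents M σ) (e : VecTerm) (he : e.Valid σ) {k : Fin L.numVars}
    (hk : M.int 4 = k) : e.compile.eval M = e.value σ k := by
  induction e with
  | zero => exact Int.cast_zero
  | vec l i => rw [VecTerm.compile, RExpr.eval, h.eval_vecAddress, hk, h.vec, VecTerm.value]
  | point p =>
    simp only [VecTerm.compile, RExpr.eval, IExpr.eval, h.eval_intTerm, h.numVars, hk]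
    exact h.real_point he k
  | add u v ihu ihv => exact congrArg₂ _ (ihu he.1) (ihv he.2)
  | sub u v ihu ihv => exact congrArg₂ _ (ihu he.1) (ihv he.2)
  | smul a v ih => exact congrArg₂ _ (h.eval_realTerm a) (ih he)

theorem holds_cond (h : Represents M σ) (b : Cond) : b.compile.Holds M ↔ b.Holds σ := by
  induction b with
  | ile a b => simp only [Cond.compile, Test.Holds, h.eval_intTerm, Cond.Holds]
  | rle a b => simp only [Cond.compile, Test.Holds, h.eval_realTerm, Cond.Holds]
  | not p ih => exact not_congr ih
  | and p q ihp ihq => exact and_congr ihp ihq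

end Represents

section LocalEffects

variable {σ : State L} (l i : ℕ) (v : Fin L.numVars → ℝ)

theorem IntTerm.value_setVec (e : IntTerm) : e.value (σ.setVec l i v) = e.value σ := by
  induction e <;> simp_all only [IntTerm.value, State.setVec_reg, State.setVec_cursor,
    State.setVec_flag]

theorem IntTerm.value_setScalar (s : Scalar) (a : ℝ) (e : IntTerm) :
    e.value (σ.setScalar s a) = e.value σ := by
  induction e <;> simp_all only [IntTerm.value, State.setScalar_reg, State.setScalar_cursor,
    State.setScalar_flag]

theorem RealTerm.value_setVec (e : RealTerm) : e.value (σ.setVec l i v) = e.value σ := by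
  induction e <;> simp_all only [RealTerm.value, State.setVec_scalar]

theorem VecTerm.valid_setVec (e : VecTerm) : e.Valid (σ.setVec l i v) ↔ e.Valid σ := by
  induction e <;> simp_all only [VecTerm.Valid, IntTerm.value_setVec]

theorem VecTerm.value_setVec_apply (e : VecTerm) {k : Fin L.numVars} (hv : v k = σ.vec l i k) :
    e.value (σ.setVec l i v) k = e.value σ k := by
  induction e with
  | zero => rfl
  | vec l' i' =>
    simp only [VecTerm.value, IntTerm.value_setVec, State.setVec_vec]
    split_ifs with hli
    · rw [hv, hli.1, hli.2]
    · rfl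
  | point p => simp only [VecTerm.value, IntTerm.value_setVec]
  | add u v ihu ihv => exact congrArg₂ _ ihu ihv
  | sub u v ihu ihv => exact congrArg₂ (· - ·) ihu ihv
  | smul a v ih => exact congrArg₂ _ (RealTerm.value_setVec _ _ _ a) ih

end LocalEffects

/-! ### A Hoare logic with time -/

/-- The unit in which time is counted: a fixed number of vector operations. -/
def Layout.unit (L : Layout) : ℕ := 1000 * (L.numVars + 1)

theorem Layout.le_unit (L : Layout) : 1000 ≤ L.unit := by unfold Layout.unit; omega

/-- From the values `σ` of the variables on, the program `c` halts within `q` units of time, and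
then the variables satisfy `Q`. One time step is left over, to pay for a sequential composition. -/
def HaltsWithin (c : Prog) (σ : State L) (q : ℕ) (Q : State L → Prop) : Prop :=
  ∀ M, Represents M σ → ∃ t M' σ', Runs c M t M' ∧ t + 1 ≤ q * L.unit ∧ Represents M' σ' ∧ Q σ'

namespace HaltsWithin

variable {b : Cond} {c d : Prog} {σ : State L} {q r : ℕ} {Q : State L → Prop}

theorem mono {q' : ℕ} {Q' : State L → Prop} (h : HaltsWithin c σ q Q) (hq : q ≤ q')
    (hQ : ∀ σ', Q σ' → Q' σ') : HaltsWithin c σ q' Q' := fun M hM => by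
  obtain ⟨t, M', σ', hrun, ht, hM', hσ'⟩ := h M hM
  exact ⟨t, M', σ', hrun, ht.trans (Nat.mul_le_mul_right _ hq), hM', hQ _ hσ'⟩

theorem mono_time {q' : ℕ} (h : HaltsWithin c σ q Q) (hq : q ≤ q') : HaltsWithin c σ q' Q :=
  h.mono hq fun _ => id

theorem seq (h : HaltsWithin c σ q fun σ' => HaltsWithin d σ' r Q) :
    HaltsWithin (.seq c d) σ (q + r) Q := fun M hM => by
  obtain ⟨t, M', σ', hc, ht, hM', hσ'⟩ := h M hM
  obtain ⟨t', M'', σ'', hd, ht', hM'', hσ''⟩ := hσ' M' hM'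
  exact ⟨_, M'', σ'', hc.seq hd, by rw [add_mul]; omega, hM'', hσ''⟩

theorem cons (h : HaltsWithin c σ 1 fun σ' => HaltsWithin d σ' r Q) :
    HaltsWithin (.seq c d) σ (r + 1) Q :=
  add_comm 1 r ▸ h.seq

theorem skip (h : Q σ) : HaltsWithin .skip σ 1 Q := fun M hM =>
  ⟨_, M, σ, .skip M, by have := L.le_unit; omega, hM, h⟩

theorem ite (hc : b.Holds σ → HaltsWithin c σ q Q) (hd : ¬ b.Holds σ → HaltsWithin d σ r Q)
    (hb : b.compile.cost ≤ 500 := by decide) :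
    HaltsWithin (.ite b.compile c d) σ (q + r + 1) Q := fun M hM => by
  have hunit := L.le_unit
  by_cases h : b.Holds σ
  · obtain ⟨t, M', σ', hrun, ht, hM', hσ'⟩ := hc h M hM
    exact ⟨_, M', σ', .ite_true ((hM.holds_cond b).2 h) hrun, by rw [add_mul, add_mul]; omega,
      hM', hσ'⟩
  · obtain ⟨t, M', σ', hrun, ht, hM', hσ'⟩ := hd h M hM
    exact ⟨_, M', σ', .ite_false (mt (hM.holds_cond b).1 h) hrun,
      by rw [add_mul, add_mul]; omega, hM', hσ'⟩

theorem loop_false (h : ¬ b.Holds σ) (hQ : Q σ) (hb : b.compile.cost ≤ 500 := by decide) :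
    HaltsWithin (.loop b.compile c) σ 1 Q := fun M hM =>
  ⟨_, M, σ, .loop_false (mt (hM.holds_cond b).1 h), by have := L.le_unit; omega, hM, hQ⟩

theorem loop_true (h : b.Holds σ)
    (hc : HaltsWithin c σ q fun σ' => HaltsWithin (.loop b.compile c) σ' r Q)
    (hb : b.compile.cost ≤ 500 := by decide) :
    HaltsWithin (.loop b.compile c) σ (q + r + 1) Q := fun M hM => by
  have hunit := L.le_unit
  obtain ⟨t, M', σ', hbody, ht, hM', hσ'⟩ := hc M hM
  obtain ⟨t', M'', σ'', hrest, ht', hM'', hσ''⟩ := hσ' M' hM'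
  exact ⟨_, M'', σ'', .loop_true ((hM.holds_cond b).2 h) hbody hrest,
    by rw [add_mul, add_mul]; omega, hM'', hσ''⟩

theorem of_istore {a e : IExpr} (x : Cell) (v : ℕ)
    (haddr : ∀ M, Represents M σ → a.eval M = x.address)
    (hval : ∀ M, Represents M σ → e.eval M = v)
    (hcost : a.cost + e.cost ≤ 900) (h : Q (σ.set x v)) :
    HaltsWithin (.istore a e) σ 1 Q := fun M hM =>
  ⟨_, _, _, .istore _ _ _, by have := L.le_unit; omega,
    by rw [haddr M hM, hval M hM]; exact hM.setInt x v, h⟩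

end HaltsWithin

def setReg (r : Reg) (e : IntTerm) : Prog := .istore (.const (8 + 3 * r.code)) e.compile

def setCursor (l e : IntTerm) : Prog := .istore (cursorAddress l.compile) e.compile

def setFlag (p e : IntTerm) : Prog := .istore (flagAddress p.compile) e.compile

def setScalar (s : Scalar) (e : RealTerm) : Prog := .rstore (scalarAddress s) e.compile

/-- `for r := 0 to e - 1 do c`. -/
def forReg (r : Reg) (e : IntTerm) (c : Prog) : Prog := forLoop (8 + 3 * r.code) e.compile c

namespace HaltsWithin

variable {σ : State L} {Q : State L → Prop}

theorem setReg {r : Reg} {e : IntTerm} (h : Q (σ.setReg r (e.value σ)))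
    (he : e.compile.cost ≤ 500 := by decide) : HaltsWithin (RealRAM.setReg r e) σ 1 Q :=
  of_istore (.reg r) _ (fun _ _ => rfl) (fun _ hM => hM.eval_intTerm e)
    (by simp only [IExpr.cost]; omega) h

theorem setCursor {l e : IntTerm} (h : Q (σ.setCursor (l.value σ) (e.value σ)))
    (he : l.compile.cost + e.compile.cost ≤ 500 := by decide) :
    HaltsWithin (RealRAM.setCursor l e) σ 1 Q :=
  of_istore (.cursor (l.value σ)) _
    (fun _ hM => by simp only [cursorAddress, IExpr.eval, hM.eval_intTerm, Cell.address])
    (fun _ hM => hM.eval_intTerm e) (by simp only [cursorAddress, IExpr.cost]; omega) h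

theorem setFlag {p e : IntTerm} (h : Q (σ.setFlag (p.value σ) (e.value σ)))
    (he : p.compile.cost + e.compile.cost ≤ 500 := by decide) :
    HaltsWithin (RealRAM.setFlag p e) σ 1 Q :=
  of_istore (.flag (p.value σ)) _
    (fun _ hM => by simp only [flagAddress, IExpr.eval, hM.eval_intTerm, Cell.address])
    (fun _ hM => hM.eval_intTerm e) (by simp only [flagAddress, IExpr.cost]; omega) h

theorem setScalar {s : Scalar} {e : RealTerm} (h : Q (σ.setScalar s (e.value σ)))
    (he : e.compile.cost ≤ 500 := by decide) : HaltsWithin (RealRAM.setScalar s e) σ 1 Q :=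
  fun M hM => ⟨_, _, _, .rstore _ _ _,
    by have := L.le_unit; simp only [scalarAddress, IExpr.cost]; omega,
    by rw [hM.eval_scalarAddress, hM.eval_realTerm]; exact hM.setScalar s _, h⟩

theorem forReg {r : Reg} {e : IntTerm} {c : Prog} {q m : ℕ} (I : ℕ → State L → Prop)
    (hI : I 0 σ) (hm : ∀ k σ', I k σ' → e.value (σ'.setReg r k) = m)
    (hc : ∀ k σ', k < m → I k σ' →
      HaltsWithin c (σ'.setReg r k) q fun σ'' => σ''.reg r = k ∧ I (k + 1) σ'')
    (hQ : ∀ σ', I m σ' → Q (σ'.setReg r m)) (he : e.compile.cost ≤ 500 := by decide) :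
    HaltsWithin (RealRAM.forReg r e c) σ (m * (q + 1) + 1) Q := fun M hM => by
  have hunit := L.le_unit
  have hloop : LoopInvariant (8 + 3 * r.code) e.compile c m (q * L.unit)
      fun k M => ∃ σ', I k σ' ∧ Represents M (σ'.setReg r k) :=
    { counter := fun k M ⟨σ', _, hM⟩ => (hM.cell (.reg r)).trans (by simp [State.get])
      bound := fun k M ⟨σ', hσ', hM⟩ => by rw [hM.eval_intTerm, hm k σ' hσ']
      body := fun k M hk ⟨σ', hσ', hM⟩ => by
        obtain ⟨t, M', σ'', hrun, ht, hM', hr, hσ''⟩ := hc k σ' hk hσ' M hM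
        exact ⟨t, M', hrun, by omega, (hM'.cell (.reg r)).trans hr, σ'', hσ'',
          hM'.setInt (.reg r) _⟩ }
  obtain ⟨t, M', hrun, ht, σ', hσ', hM'⟩ := hloop.runs_forLoop ⟨σ, hI, hM.setInt (.reg r) _⟩
  refine ⟨t, M', _, hrun, ?_, hM', hQ _ hσ'⟩
  have : m * (q * L.unit + e.compile.cost + 20) ≤ m * ((q + 1) * L.unit) :=
    Nat.mul_le_mul_left _ (by rw [add_mul]; omega)
  rw [add_mul, mul_assoc]
  omega

end HaltsWithin

/-! ### Vector instructions -/

/-- `for k := 0 to numVars - 1 do body`, where the counter is the hidden integer cell `4`. -/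
def coordLoop (body : Prog) : Prog := forLoop 4 (.load (.const 0)) body

theorem runs_coordLoop {body : Prog} {b : ℕ} (σ : ℕ → State L) (A : ℕ → Mem → Prop)
    (hA : ∀ k v M, A k M → A k (M.setInt 4 v))
    (hbody : ∀ (k : Fin L.numVars) M, M.int 4 = (k : ℕ) → Represents M (σ k) → A k M →
      ∃ t M', Runs body M t M' ∧ t ≤ b ∧ M'.int 4 = (k : ℕ) ∧ Represents M' (σ (k + 1)) ∧
        A (k + 1) M')
    {M : Mem} (hM : Represents M (σ 0)) (hAM : A 0 M) :
    ∃ t M', Runs (coordLoop body) M t M' ∧ t ≤ L.numVars * (b + 22) + 22 ∧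
      Represents M' (σ L.numVars) ∧ A L.numVars M' := by
  have hloop : LoopInvariant 4 (.load (.const 0)) body L.numVars b
      fun k M => M.int 4 = k ∧ Represents M (σ k) ∧ A k M :=
    { counter := fun k M hM => hM.1
      bound := fun k M hM => hM.2.1.numVars
      body := fun k M hk ⟨hcount, hM, hAM⟩ => by
        obtain ⟨t, M', hrun, ht, hcount', hM', hAM'⟩ := hbody ⟨k, hk⟩ M hcount hM hAM
        exact ⟨t, M', hrun, ht, hcount', by simp [Mem.setInt],
          hM'.setInt_of_hidden le_rfl (by omega) _, hA _ _ _ hAM'⟩ }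
  obtain ⟨t, M', hrun, ht, -, hM', hAM'⟩ := hloop.runs_forLoop (M := M)
    ⟨by simp [Mem.setInt], hM.setInt_of_hidden le_rfl (by omega) 0, hA _ _ _ hAM⟩
  exact ⟨t, M', hrun, ht, hM', hAM'⟩

/-- Assign `e` to the vector `(l, i)`, coordinate by coordinate. -/
def setVec (l i : IntTerm) (e : VecTerm) : Prog :=
  coordLoop (.rstore (vecAddress l i) e.compile)

/-- Assign the scalar product of `u` and `v` to the scalar `s`. -/
def dot (s : Scalar) (u v : VecTerm) : Prog :=
  .seq (.rstore (.load (.const 2)) (.const 0))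
    (.seq (coordLoop (.rstore (.load (.const 2))
      (.add (.load (.load (.const 2))) (.mul u.compile v.compile))))
    (.rstore (scalarAddress s) (.load (.load (.const 2)))))

/-- Set the register `r` to `1` or `0` according as all coordinates of `e` are nonnegative or
not. -/
def allNonneg (r : Reg) (e : VecTerm) : Prog :=
  .seq (.istore (.const 5) (.const 1))
    (.seq (coordLoop (.ite (.rle (.const 0) e.compile) .skip (.istore (.const 5) (.const 0))))
    (.istore (.const (8 + 3 * r.code)) (.load (.const 5))))

theorem sum_range_dite_eq_dotProduct {n : ℕ} (u v : Fin n → ℝ) :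
    (∑ j ∈ Finset.range n, if h : j < n then u ⟨j, h⟩ * v ⟨j, h⟩ else 0) = u ⬝ᵥ v := by
  simp [Finset.sum_range, dotProduct]

namespace HaltsWithin

variable {σ : State L} {Q : State L → Prop}

theorem setVec {l i : IntTerm} {e : VecTerm} (he : e.Valid σ)
    (h : Q (σ.setVec (l.value σ) (i.value σ) (e.value σ)))
    (hcost : (vecAddress l i).cost + e.compile.cost ≤ 900 := by decide) :
    HaltsWithin (RealRAM.setVec l i e) σ 1 Q := fun M hM => by
  let τ (k : ℕ) : State L := σ.setVec (l.value σ) (i.value σ)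
    fun j => if (j : ℕ) < k then e.value σ j else σ.vec (l.value σ) (i.value σ) j
  have hzero : τ 0 = σ := by
    simp only [τ, not_lt_zero, if_false, State.setVec_vec_self]
  have hlast : τ L.numVars = σ.setVec (l.value σ) (i.value σ) (e.value σ) := by
    simp only [τ, Fin.is_lt, if_true]
  have hbody (k : Fin L.numVars) (M : Mem) (hk : M.int 4 = k) (hM : Represents M (τ k)) :
      Represents (M.setReal ((vecAddress l i).eval M) (e.compile.eval M)) (τ (k + 1)) := by
    rw [hM.eval_vecAddress, hM.eval_vecTerm e ((VecTerm.valid_setVec ..).2 he) hk, hk,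
      VecTerm.value_setVec_apply _ _ _ _ (by simp), IntTerm.value_setVec, IntTerm.value_setVec]
    convert hM.setCoord (l.value σ) (i.value σ) k (e.value σ k) using 1
    simp only [τ, State.setVec_setVec]
    congr 1
    ext j
    simp only [State.setVec_vec, and_self, if_true, Function.update_apply, Fin.ext_iff]
    grind
  obtain ⟨t, M', hrun, ht, hM', -⟩ := runs_coordLoop τ (fun _ _ => True) (fun _ _ _ _ => trivial)
    (fun k M hk hM _ => ⟨_, _, .rstore _ _ _, le_rfl, hk, hbody k M hk hM, trivial⟩)
    (hzero ▸ hM) trivial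
  refine ⟨t, M', _, hrun, ?_, hlast ▸ hM', h⟩
  have : L.numVars * ((vecAddress l i).cost + e.compile.cost + 1 + 22) ≤ L.numVars * 1000 :=
    Nat.mul_le_mul_left _ (by omega)
  unfold Layout.unit
  omega

theorem dot {s : Scalar} {u v : VecTerm} (hu : u.Valid σ) (hv : v.Valid σ)
    (h : Q (σ.setScalar s (u.value σ ⬝ᵥ v.value σ)))
    (hcost : u.compile.cost + v.compile.cost ≤ 900 := by decide) :
    HaltsWithin (RealRAM.dot s u v) σ 1 Q := fun M hM => by
  let partialSum (k : ℕ) : ℝ := ∑ j ∈ Finset.range k,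
    if h : j < L.numVars then u.value σ ⟨j, h⟩ * v.value σ ⟨j, h⟩ else 0
  have hinit : Represents (M.setReal L.base 0) σ := hM.setReal_base 0
  obtain ⟨t, M', hrun, ht, hM', hsum⟩ := runs_coordLoop (body := .rstore (.load (.const 2))
      (.add (.load (.load (.const 2))) (.mul u.compile v.compile))) (fun _ => σ)
    (fun k M => M.real L.base = partialSum k) (fun _ _ _ hM => hM)
    (fun k M hk hM hsum => ⟨_, _, .rstore _ _ _, le_rfl, hk, by
        simpa only [IExpr.eval, hM.base] using hM.setReal_base _, by
        simp [IExpr.eval, RExpr.eval, hM.base, Mem.setReal, hsum, hM.eval_vecTerm u hu hk,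
          hM.eval_vecTerm v hv hk, partialSum, Finset.sum_range_succ]⟩)
    hinit (by simp [Mem.setReal, partialSum])
  have hlast : partialSum L.numVars = u.value σ ⬝ᵥ v.value σ := sum_range_dite_eq_dotProduct _ _
  have hstore := Runs.rstore (scalarAddress s) (.load (.load (.const 2))) M'
  rw [hM'.eval_scalarAddress, RExpr.eval, IExpr.eval, IExpr.eval, hM'.base, hsum, hlast]
    at hstore
  have hclear := Runs.rstore (.load (.const 2)) (.const 0) M
  rw [IExpr.eval, IExpr.eval, hM.base, RExpr.eval, Int.cast_zero] at hclear
  refine ⟨_, _, _, hclear.seq (hrun.seq hstore), ?_, hM'.setScalar s _, h⟩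
  simp only [IExpr.cost, RExpr.cost, scalarAddress, Layout.unit] at ht ⊢
  have : L.numVars * (1 + 1 + (1 + 1 + 1 + (u.compile.cost + v.compile.cost + 1) + 1) + 1 + 22) ≤
    L.numVars * 1000 := Nat.mul_le_mul_left _ (by omega)
  omega

open Classical in
theorem allNonneg {r : Reg} {e : VecTerm} (he : e.Valid σ)
    (h : Q (σ.setReg r (if 0 ≤ e.value σ then 1 else 0)))
    (hcost : e.compile.cost ≤ 900 := by decide) :
    HaltsWithin (RealRAM.allNonneg r e) σ 1 Q := fun M hM => by
  let prefixFlag (k : ℕ) : ℕ :=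
    if ∀ j : Fin L.numVars, (j : ℕ) < k → 0 ≤ e.value σ j then 1 else 0
  have prefixFlag_succ (k : Fin L.numVars) :
      prefixFlag (k + 1) = if 0 ≤ e.value σ k then prefixFlag k else 0 := by
    simp only [prefixFlag, Nat.lt_succ_iff_lt_or_eq, Fin.val_inj, or_imp, forall_and, forall_eq]
    grind
  have hinit : Represents (M.setInt 5 1) σ := hM.setInt_of_hidden (by omega) (by omega) 1
  obtain ⟨t, M', hrun, ht, hM', hflag⟩ := runs_coordLoop (b := e.compile.cost + 10)
    (body := .ite (.rle (.const 0) e.compile) .skip (.istore (.const 5) (.const 0))) (fun _ => σ)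
    (fun k M => M.int 5 = prefixFlag k) (fun _ _ _ hM => hM)
    (fun k M hk hM hflag => by
      have hval : (Test.rle (.const 0) e.compile).Holds M ↔ 0 ≤ e.value σ k := by
        simp only [Test.Holds, RExpr.eval, hM.eval_vecTerm e he hk, Int.cast_zero]
      by_cases hpos : (Test.rle (.const 0) e.compile).Holds M
      · refine ⟨_, M, .ite_true hpos (.skip M), ?_, hk, hM, ?_⟩
        · simp only [Test.cost, RExpr.cost]; omega
        · rw [prefixFlag_succ, if_pos (hval.1 hpos), hflag]
      · refine ⟨_, _, .ite_false hpos (.istore _ _ _), ?_, ?_,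
          hM.setInt_of_hidden (by simp [IExpr.eval]) (by simp [IExpr.eval]) _, ?_⟩
        · simp only [Test.cost, RExpr.cost, IExpr.cost]; omega
        · simp [Mem.setInt, IExpr.eval, hk]
        · rw [prefixFlag_succ, if_neg (mt hval.2 hpos)]
          simp [Mem.setInt, IExpr.eval])
    hinit (by simp [Mem.setInt, prefixFlag])
  have hlast : prefixFlag L.numVars = if 0 ≤ e.value σ then 1 else 0 := by
    simp only [prefixFlag, Fin.is_lt, true_imp_iff, Pi.le_def, Pi.zero_apply]
  have hstore := Runs.istore (.const (8 + 3 * r.code)) (.load (.const 5)) M'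
  rw [IExpr.eval, IExpr.eval, IExpr.eval, hflag, hlast] at hstore
  refine ⟨_, _, _, .seq (.istore _ _ _) (hrun.seq hstore), ?_, hM'.setInt (.reg r) _, h⟩
  simp only [IExpr.cost, Layout.unit]
  have : L.numVars * (e.compile.cost + 10 + 22) ≤ L.numVars * 1000 :=
    Nat.mul_le_mul_left _ (by omega)
  omega

end HaltsWithin

/-- Put the component of `v` orthogonal to `p` into the vector `(l, i)`. -/
def project (l i : IntTerm) (v p : VecTerm) : Prog :=
  .seq (dot .fst v p) (.seq (dot .snd p p)
    (setVec l i (.sub v (.smul (.div (.scalar .fst) (.scalar .snd)) p))))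

/-- `σ'` differs from `σ` at most in the registers in `S` and in the scalars. -/
structure AgreesOff (S : Set Reg) (σ σ' : State L) : Prop where
  reg : ∀ r ∉ S, σ'.reg r = σ.reg r
  cursor : σ'.cursor = σ.cursor
  flag : σ'.flag = σ.flag
  vec : σ'.vec = σ.vec

namespace AgreesOff

variable {S T : Set Reg} {σ σ' σ'' : State L}

theorem refl (S : Set Reg) (σ : State L) : AgreesOff S σ σ := ⟨fun _ _ => rfl, rfl, rfl, rfl⟩

theorem mono (h : AgreesOff S σ σ') (hST : S ⊆ T) : AgreesOff T σ σ' :=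
  ⟨fun r hr => h.reg r fun hrS => hr (hST hrS), h.cursor, h.flag, h.vec⟩

theorem trans (h : AgreesOff S σ σ') (h' : AgreesOff S σ' σ'') : AgreesOff S σ σ'' :=
  ⟨fun r hr => (h'.reg r hr).trans (h.reg r hr), h'.cursor.trans h.cursor, h'.flag.trans h.flag,
    h'.vec.trans h.vec⟩

theorem setReg (h : AgreesOff S σ σ') {r : Reg} (hr : r ∈ S) (v : ℕ) :
    AgreesOff S σ (σ'.setReg r v) :=
  ⟨fun r' hr' => by
      rw [State.setReg_reg, Function.update_of_ne (by rintro rfl; exact hr' hr), h.reg r' hr'],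
    h.cursor, h.flag, h.vec⟩

theorem withScalar (h : AgreesOff S σ σ') (f : Scalar → ℝ) :
    AgreesOff S σ { σ' with scalar := f } :=
  ⟨h.reg, h.cursor, h.flag, h.vec⟩

theorem setVec (h : AgreesOff S σ σ') (l i : ℕ) (v : Fin L.numVars → ℝ) :
    AgreesOff S (σ.setVec l i v) (σ'.setVec l i v) :=
  ⟨h.reg, h.cursor, h.flag, by simp only [State.setVec, h.vec]⟩

end AgreesOff

theorem HaltsWithin.project {l i l' i' l'' i'' : IntTerm} {σ : State L} {Q : State L → Prop}
    (h : ∀ f, Q ({ σ with scalar := f }.setVec (l.value σ) (i.value σ)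
      (orthComp (σ.vec (l'.value σ) (i'.value σ)) (σ.vec (l''.value σ) (i''.value σ)))))
    (hcost : l.compile.cost + i.compile.cost + l'.compile.cost + i'.compile.cost +
      l''.compile.cost + i''.compile.cost ≤ 100 := by decide) :
    HaltsWithin (RealRAM.project l i (.vec l' i') (.vec l'' i'')) σ 3 Q := by
  refine cons (dot trivial trivial ?_ ?_)
  · refine cons (dot trivial trivial (setVec ⟨trivial, trivial⟩ ?_ ?_) ?_)
    · simp only [IntTerm.value_setScalar, VecTerm.value, RealTerm.value]
      exact h _
    all_goals
      simp only [VecTerm.compile, RealTerm.compile, vecAddress, RealRAM.scalarAddress, RExpr.cost,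
        IExpr.cost]
      omega
  · simp only [VecTerm.compile, vecAddress, RExpr.cost, IExpr.cost]
    omega

/-! ### Systems in one unknown -/

/-- The constraints at the current level. -/
def State.system (σ : State L) (j : ℕ) : Fin L.numVars → ℝ := σ.vec (σ.reg .level) (j + 1)

/-- The number `t` respects those of the bounds `lower` and `upper` that are present. -/
def State.Admits (σ : State L) (t : ℝ) : Prop :=
  (σ.reg .hasLower = 0 ∨ σ.scalar .lower < t) ∧ (σ.reg .hasUpper = 0 ∨ t < σ.scalar .upper)

/-- Raise the lower bound to `-(fst / snd)`, if this is an improvement. -/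
def tightenLower : Prog :=
  .seq (setScalar .param (.sub (.const 0) (.div (.scalar .fst) (.scalar .snd))))
    (.ite (Cond.and (.ile (.const 1) (.reg .hasLower))
        (.rle (.scalar .param) (.scalar .lower))).compile
      .skip (.seq (setScalar .lower (.scalar .param)) (setReg .hasLower (.const 1))))

/-- Reduce the upper bound to `-(fst / snd)`, if this is an improvement. -/
def tightenUpper : Prog :=
  .seq (setScalar .param (.sub (.const 0) (.div (.scalar .fst) (.scalar .snd))))
    (.ite (Cond.and (.ile (.const 1) (.reg .hasUpper))
        (.rle (.scalar .upper) (.scalar .param))).compile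
      .skip (.seq (setScalar .upper (.scalar .param)) (setReg .hasUpper (.const 1))))

/-- Make the bounds contradictory. -/
def rejectAll : Prog :=
  .seq (setReg .hasLower (.const 1)) (.seq (setReg .hasUpper (.const 1))
    (.seq (setScalar .lower (.const 0)) (setScalar .upper (.const 0))))

/-- Impose on `t` the inequality `0 < fst + t * snd`. -/
def restrict : Prog :=
  .ite (Cond.rle (.scalar .snd) (.const 0)).compile
    (.ite (Cond.rle (.const 0) (.scalar .snd)).compile
      (.ite (Cond.rle (.scalar .fst) (.const 0)).compile rejectAll .skip)
      tightenUpper)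
    tightenLower

/-- Impose on `t` the inequality `0 < (x + t • y) ⬝ᵥ a`, where `x` and `y` are the vectors `(0, 0)`
and `(0, 1)` and `a` is the constraint `iter` of the current level. -/
def addConstraint : Prog :=
  .seq (dot .fst (.vec (.const 0) (.const 0)) (.vec (.reg .level) (.add (.reg .iter) (.const 1))))
    (.seq (dot .snd (.vec (.const 0) (.const 1))
      (.vec (.reg .level) (.add (.reg .iter) (.const 1))))
    restrict)

/-- The bounds are contradictory. -/
def emptyInterval : Cond :=
  .and (.ile (.const 1) (.reg .hasLower))
    (.and (.ile (.const 1) (.reg .hasUpper)) (.rle (.scalar .upper) (.scalar .lower)))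

/-- Put a number between the bounds into the scalar `param`. -/
def chooseParam : Prog :=
  .ite (Cond.ile (.const 1) (.reg .hasUpper)).compile
    (.ite (Cond.ile (.const 1) (.reg .hasLower)).compile
      (setScalar .param (.div (.add (.scalar .lower) (.scalar .upper)) (.const 2)))
      (setScalar .param (.sub (.scalar .upper) (.const 1))))
    (setScalar .param (.add (.scalar .lower) (.const 1)))

/-- Impose on `t` the first `count` constraints of the current level. -/
def scanConstraints : Prog :=
  .seq (setReg .hasLower (.const 0)) (.seq (setReg .hasUpper (.const 0))
    (forReg .iter (.reg .count) addConstraint))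

/-- Look for a solution of the first `count` constraints of the current level on the line
`x + ℝ • y`, where `x` and `y` are the vectors `(0, 0)` and `(0, 1)`. -/
def searchLine : Prog :=
  .seq scanConstraints (.ite emptyInterval.compile (setReg .status (.const 0))
    (.seq chooseParam (setVec (.reg .level) (.const 0) (.add (.vec (.const 0) (.const 0))
      (.smul (.scalar .param) (.vec (.const 0) (.const 1)))))))

/-- The registers that hold the current interval. -/
abbrev intervalRegs : Set Reg := {.hasLower, .hasUpper}

/-- `σ'` differs from `σ` at most in scratch registers, scalars and vectors. -/
structure SameControl (σ σ' : State L) : Prop where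
  point : σ'.reg .point = σ.reg .point
  level : σ'.reg .level = σ.reg .level
  status : σ'.reg .status = σ.reg .status
  cursor : σ'.cursor = σ.cursor
  flag : σ'.flag = σ.flag

/-- The state reached from `σ` when the system has turned out to be infeasible. -/
structure Failed (σ σ' : State L) : Prop where
  point : σ'.reg .point = σ.reg .point
  status : σ'.reg .status = 0
  flag : σ'.flag = σ.flag

theorem State.Admits.not_holds_emptyInterval {σ : State L} {t : ℝ} (h : σ.Admits t) :
    ¬ emptyInterval.Holds σ := by
  simp only [State.Admits, emptyInterval, Cond.Holds, IntTerm.value, RealTerm.value] at h ⊢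
  grind

theorem add_mul_pos_iff_of_pos {α β t : ℝ} (h : 0 < β) : 0 < α + t * β ↔ 0 - α / β < t := by
  rw [zero_sub, ← neg_div, div_lt_iff₀ h, neg_lt_iff_pos_add']

theorem add_mul_pos_iff_of_neg {α β t : ℝ} (h : β < 0) : 0 < α + t * β ↔ t < 0 - α / β := by
  rw [zero_sub, ← neg_div, lt_div_iff_of_neg h, neg_lt_iff_pos_add']

namespace HaltsWithin

variable {σ : State L} {Q : State L → Prop}

theorem tightenLower (hQ : ∀ σ', AgreesOff intervalRegs σ σ' →
      (∀ t, σ'.Admits t ↔ σ.Admits t ∧ 0 - σ.scalar .fst / σ.scalar .snd < t) → Q σ') :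
    HaltsWithin tightenLower σ 5 Q := by
  refine cons (setScalar (ite (q := 1) (r := 2) (fun hold => skip ?_)
    fun hnew => cons (setScalar (setReg ?_))))
  · refine hQ _ ((AgreesOff.refl _ σ).withScalar _) fun t => ?_
    simp [Cond.Holds, IntTerm.value, RealTerm.value, State.Admits] at hold ⊢
    grind
  · refine hQ _ (((AgreesOff.refl _ σ).withScalar _).setReg (by simp) _)
      fun t => ?_
    simp [Cond.Holds, IntTerm.value, RealTerm.value, State.Admits] at hnew ⊢
    grind

theorem tightenUpper (hQ : ∀ σ', AgreesOff intervalRegs σ σ' →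
      (∀ t, σ'.Admits t ↔ σ.Admits t ∧ t < 0 - σ.scalar .fst / σ.scalar .snd) → Q σ') :
    HaltsWithin tightenUpper σ 5 Q := by
  refine cons (setScalar (ite (q := 1) (r := 2) (fun hold => skip ?_)
    fun hnew => cons (setScalar (setReg ?_))))
  · refine hQ _ ((AgreesOff.refl _ σ).withScalar _) fun t => ?_
    simp [Cond.Holds, IntTerm.value, RealTerm.value, State.Admits] at hold ⊢
    grind
  · refine hQ _ (((AgreesOff.refl _ σ).withScalar _).setReg (by simp) _)
      fun t => ?_
    simp [Cond.Holds, IntTerm.value, RealTerm.value, State.Admits] at hnew ⊢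
    grind

theorem rejectAll (hQ : ∀ σ', AgreesOff intervalRegs σ σ' → (∀ t, ¬ σ'.Admits t) → Q σ') :
    HaltsWithin rejectAll σ 4 Q := by
  refine cons (setReg (cons (setReg (cons (setScalar (setScalar (hQ _ ?_ fun t => ?_)))))))
  · exact (((AgreesOff.refl _ σ).setReg (by simp) _).setReg (by simp) _).withScalar _
  · simpa [State.Admits, IntTerm.value, RealTerm.value] using le_of_lt

theorem restrict (hQ : ∀ σ', AgreesOff intervalRegs σ σ' →
      (∀ t, σ'.Admits t ↔ σ.Admits t ∧ 0 < σ.scalar .fst + t * σ.scalar .snd) → Q σ') :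
    HaltsWithin restrict σ 18 Q := by
  refine ite (q := 12) (r := 5) (fun hle => ite (q := 6) (r := 5) (fun hge => ?_) fun hneg => ?_)
    fun hpos => ?_
  all_goals simp only [Cond.Holds, RealTerm.value, Int.cast_zero, not_le] at *
  · have hzero : σ.scalar .snd = 0 := le_antisymm hle hge
    simp only [hzero, mul_zero, add_zero] at hQ
    refine ite (q := 4) (r := 1) (fun hfst => rejectAll fun σ' hσ' hadm => ?_) fun hfst => skip ?_
    all_goals simp only [Cond.Holds, RealTerm.value, Int.cast_zero, not_le] at hfst
    · exact hQ σ' hσ' fun t => iff_of_false (hadm t) fun h => h.2.not_ge hfst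
    · exact hQ σ (.refl _ σ) fun t => (and_iff_left hfst).symm
  · exact tightenUpper (by simpa only [add_mul_pos_iff_of_neg hneg] using hQ)
  · exact tightenLower (by simpa only [add_mul_pos_iff_of_pos hpos] using hQ)

theorem addConstraint (hQ : ∀ σ', AgreesOff intervalRegs σ σ' →
      (∀ t, σ'.Admits t ↔ σ.Admits t ∧
        0 < (σ.vec 0 0 + t • σ.vec 0 1) ⬝ᵥ σ.system (σ.reg .iter)) → Q σ') :
    HaltsWithin addConstraint σ 20 Q := by
  refine cons (dot trivial trivial (cons (dot trivial trivial (restrict fun σ' hσ' hadm =>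
    hQ σ' ⟨hσ'.reg, hσ'.cursor, hσ'.flag, hσ'.vec⟩ fun t => ?_))))
  simp only [add_dotProduct, smul_dotProduct, smul_eq_mul]
  exact hadm t

theorem chooseParam (hne : ¬ emptyInterval.Holds σ)
    (hQ : ∀ v, σ.Admits v → Q (σ.setScalar .param v)) : HaltsWithin chooseParam σ 5 Q := by
  refine ite (q := 3) (r := 1) (fun hupper => ite (q := 1) (r := 1) (fun hlower => ?_)
    fun hlower => ?_) fun hupper => ?_
  all_goals
    refine setScalar (hQ _ ?_)
    simp only [emptyInterval, Cond.Holds, IntTerm.value, RealTerm.value, State.Admits] at *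
    grind

theorem scanConstraints (hQ : ∀ σ', AgreesOff {.hasLower, .hasUpper, .iter} σ σ' →
      (∀ t, σ'.Admits t ↔
        ∀ j < σ.reg .count, 0 < (σ.vec 0 0 + t • σ.vec 0 1) ⬝ᵥ σ.system j) → Q σ') :
    HaltsWithin scanConstraints σ (σ.reg .count * 21 + 3) Q := by
  let Inv (k : ℕ) (σ' : State L) : Prop := AgreesOff {.hasLower, .hasUpper, .iter} σ σ' ∧
    ∀ t, σ'.Admits t ↔ ∀ j < k, 0 < (σ.vec 0 0 + t • σ.vec 0 1) ⬝ᵥ σ.system j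
  refine cons (setReg (cons (setReg (forReg Inv ⟨?_, fun t => ?_⟩ (fun k σ' hσ' => ?_)
    (fun k σ' _ ⟨hσ', hadm⟩ => addConstraint fun σ'' hσ'' hadm' => ⟨?_, ?_, fun t => ?_⟩)
    fun σ' ⟨hσ', hadm⟩ => hQ _ (hσ'.setReg (by simp) _) hadm))))
  · exact ((AgreesOff.refl _ σ).setReg (by simp) 0).setReg (by simp) 0
  · simp [State.Admits, IntTerm.value]
  · simp [IntTerm.value, hσ'.1.reg .count (by simp)]
  · rw [hσ''.reg .iter (by simp), State.setReg_reg, Function.update_self]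
  · exact (hσ'.setReg (by simp) k).trans (hσ''.mono (by grind))
  · have hsame : (σ'.setReg .iter k).Admits t ↔ σ'.Admits t := by simp [State.Admits]
    have hsystem : (σ'.setReg .iter k).system k = σ.system k := by
      simp [State.system, hσ'.vec, hσ'.reg .level]
    rw [hadm', hsame, hadm, Nat.forall_lt_succ_right, State.setReg_reg, Function.update_self,
      hsystem, State.setReg_vec, hσ'.vec]

theorem searchLine
    (hfail : ∀ σ', Failed σ σ' →
      (¬ ∃ t : ℝ, ∀ j < σ.reg .count, 0 < (σ.vec 0 0 + t • σ.vec 0 1) ⬝ᵥ σ.system j) → Q σ')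
    (hfound : ∀ σ' w, SameControl σ σ' → σ'.vec = (σ.setVec (σ.reg .level) 0 w).vec →
      (∀ j < σ.reg .count, 0 < w ⬝ᵥ σ.system j) → Q σ') :
    HaltsWithin searchLine σ (30 * (σ.reg .count + 1)) Q := by
  refine (seq (r := 8) (scanConstraints fun σ' hσ' hadm => ?_)).mono_time (by omega)
  refine ite (q := 1) (r := 6) (fun hempty => ?_) fun hne => seq (r := 1) (chooseParam hne
    fun v hv => ?_)
  · refine setReg (hfail _ ⟨hσ'.reg .point (by simp), rfl, hσ'.flag⟩ ?_)
    exact fun ⟨t, ht⟩ => ((hadm t).2 ht).not_holds_emptyInterval hempty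
  · refine setVec ⟨trivial, trivial⟩ (hfound _ (σ.vec 0 0 + v • σ.vec 0 1)
      ⟨hσ'.reg .point (by simp), hσ'.reg .level (by simp), hσ'.reg .status (by simp),
        hσ'.cursor, hσ'.flag⟩ ?_ ((hadm v).1 hv))
    simp [VecTerm.value, IntTerm.value, RealTerm.value, hσ'.vec, hσ'.reg .level]

end HaltsWithin

/-! ### The steps of the solver -/

/-- `σ'` has the flags, the `point` and the constraints of the level `l` in common with `σ`, and
all that belongs to higher levels. -/
structure Preserves (l : ℕ) (σ σ' : State L) : Prop where
  point : σ'.reg .point = σ.reg .point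
  flag : σ'.flag = σ.flag
  cursor : ∀ k > l, σ'.cursor k = σ.cursor k
  constraint : ∀ j, σ'.vec l (j + 1) = σ.vec l (j + 1)
  vec : ∀ k > l, σ'.vec k = σ.vec k

namespace Preserves

variable {l k : ℕ} {σ σ' σ'' : State L}

theorem refl (l : ℕ) (σ : State L) : Preserves l σ σ :=
  ⟨rfl, rfl, fun _ _ => rfl, fun _ => rfl, fun _ _ => rfl⟩

theorem withScalar (l : ℕ) (σ : State L) (f : Scalar → ℝ) :
    Preserves l σ { σ with scalar := f } :=
  ⟨rfl, rfl, fun _ _ => rfl, fun _ => rfl, fun _ _ => rfl⟩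

theorem trans (h : Preserves l σ σ') (h' : Preserves l σ' σ'') : Preserves l σ σ'' :=
  ⟨h'.point.trans h.point, h'.flag.trans h.flag, fun k hk => (h'.cursor k hk).trans (h.cursor k hk),
    fun j => (h'.constraint j).trans (h.constraint j), fun k hk => (h'.vec k hk).trans (h.vec k hk)⟩

theorem mono (h : Preserves l σ σ') (hlk : l < k) : Preserves k σ σ' :=
  ⟨h.point, h.flag, fun i hi => h.cursor i (hlk.trans hi), fun _ => congrFun (h.vec k hlk) _,
    fun i hi => h.vec i (hlk.trans hi)⟩

theorem failed (h : Preserves l σ σ') (h' : Failed σ' σ'') : Failed σ σ'' :=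
  ⟨h'.point.trans h.point, h'.status, h'.flag.trans h.flag⟩

theorem of_sameControl {w : Fin L.numVars → ℝ} (h : SameControl σ σ')
    (hvec : σ'.vec = (σ.setVec l 0 w).vec) : Preserves l σ σ' where
  point := h.point
  flag := h.flag
  cursor _ _ := congrFun h.cursor _
  constraint j := by simp [hvec]
  vec k hk := by simp [hvec, hk.ne']

end Preserves

/-- The solver works on the level `l`, and the vector `(l, 0)` solves the first `i` constraints. -/
structure Solved (l i : ℕ) (σ : State L) : Prop where
  level : σ.reg .level = l
  status : σ.reg .status = 1
  cursor : σ.cursor l = i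
  pos : ∀ j < i, 0 < σ.vec l 0 ⬝ᵥ σ.vec l (j + 1)

theorem Solved.of_sameControl {l m : ℕ} {σ σ' : State L} {w : Fin L.numVars → ℝ}
    (hlevel : σ.reg .level = l) (hstatus : σ.reg .status = 1) (hcursor : σ.cursor l = m)
    (h : SameControl σ σ') (hvec : σ'.vec = (σ.setVec l 0 w).vec)
    (hw : ∀ j < m, 0 < w ⬝ᵥ σ.vec l (j + 1)) : Solved l m σ' where
  level := h.level.trans hlevel
  status := h.status.trans hstatus
  cursor := (congrFun h.cursor l).trans hcursor
  pos j hj := by simpa [hvec] using hw j hj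

/-- From `σ` the state `σ'` has been reached by solving the first `m` constraints of the level `l`
or by discovering that this is impossible. -/
inductive Outcome (l m : ℕ) (σ σ' : State L) : Prop
  | infeasible (failed : Failed σ σ') (h : ¬ Feasible (fun j => σ.vec l (j + 1)) m)
  | solved (preserves : Preserves l σ σ') (h : Solved l m σ')

theorem Preserves.outcome {l m : ℕ} {σ σ' σ'' : State L} (h : Preserves l σ σ')
    (h' : Outcome l m σ' σ'') : Outcome l m σ σ'' := by
  rcases h' with ⟨hfail, hno⟩ | ⟨hpres, hsolved⟩
  · simp only [h.constraint] at hno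
    exact .infeasible (h.failed hfail) hno
  · exact .solved (h.trans hpres) hsolved

/-- `σ'` is reached from `σ` by projecting the first `i` constraints of the level `l + 1` along the
next one. -/
structure Descended (l i : ℕ) (σ σ' : State L) : Prop where
  preserves : Preserves (l + 1) σ σ'
  solved : Solved l 0 σ'
  cursor : σ'.cursor (l + 1) = i
  proj : ∀ j < i,
    σ'.vec l (j + 1) = orthComp (σ.vec (l + 1) (j + 1)) (σ.vec (l + 1) (i + 1))

/-- Put a non-zero component of one of the first `count` constraints of the current level
orthogonal to the vector `(0, 0)` into the vector `(0, 1)`, if there is one. -/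
def findSecondAxis : Prog :=
  forReg .iter (.reg .count)
    (.seq (dot .fst (.vec (.const 0) (.const 1)) (.vec (.const 0) (.const 1)))
      (.ite (Cond.rle (.scalar .fst) (.const 0)).compile
        (project (.const 0) (.const 1) (.vec (.reg .level) (.add (.reg .iter) (.const 1)))
          (.vec (.const 0) (.const 0)))
        .skip))

/-- Look for a solution of the first `count` constraints of the current level in a plane that
contains them, where the vector `(0, 0)` is the first of them. -/
def searchPlane : Prog := .seq findSecondAxis searchLine

/-- Solve the system of the current level if its constraints span at most a plane. -/
def plane : Prog :=
  .seq (setReg .count (.cursor (.add (.reg .level) (.const 1))))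
    (.seq (dot .fst (.vec (.reg .level) (.const 1)) (.vec (.reg .level) (.const 1)))
      (.ite (Cond.rle (.scalar .fst) (.const 0)).compile (setReg .status (.const 0))
        (.seq (setVec (.const 0) (.const 0) (.vec (.reg .level) (.const 1)))
          (.seq (setVec (.const 0) (.const 1) .zero)
            (.seq (setCursor (.reg .level) (.reg .count)) searchPlane)))))

/-- Go up one level: turn the solution of the projected system into one of the constraints up to
the one along which they have been projected. -/
def lift : Prog :=
  .seq (setReg .level (.add (.reg .level) (.const 1)))
    (.seq (project (.const 0) (.const 0) (.vec (.sub (.reg .level) (.const 1)) (.const 0))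
        (.vec (.reg .level) (.add (.cursor (.reg .level)) (.const 1))))
      (.seq (setVec (.const 0) (.const 1)
          (.vec (.reg .level) (.add (.cursor (.reg .level)) (.const 1))))
        (.seq (setCursor (.reg .level) (.add (.cursor (.reg .level)) (.const 1)))
          (.seq (setReg .count (.cursor (.reg .level))) searchLine))))

/-- Project the constraints before the current one along it, and go down one level. -/
def descend : Prog :=
  .seq (forReg .iter (.cursor (.reg .level))
      (project (.sub (.reg .level) (.const 1)) (.add (.reg .iter) (.const 1))
        (.vec (.reg .level) (.add (.reg .iter) (.const 1)))
        (.vec (.reg .level) (.add (.cursor (.reg .level)) (.const 1)))))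
    (.seq (setReg .level (.sub (.reg .level) (.const 1))) (setCursor (.reg .level) (.const 0)))

/-- Treat the current constraint of the current level. -/
def advance : Prog :=
  .seq (dot .fst (.vec (.reg .level) (.const 0))
      (.vec (.reg .level) (.add (.cursor (.reg .level)) (.const 1))))
    (.ite (Cond.rle (.scalar .fst) (.const 0)).compile
      (.seq (dot .fst (.vec (.reg .level) (.add (.cursor (.reg .level)) (.const 1)))
          (.vec (.reg .level) (.add (.cursor (.reg .level)) (.const 1))))
        (.ite (Cond.rle (.scalar .fst) (.const 0)).compile (setReg .status (.const 0)) descend))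
      (setCursor (.reg .level) (.add (.cursor (.reg .level)) (.const 1))))

namespace HaltsWithin

variable {σ : State L} {Q : State L → Prop}

theorem findSecondAxis {l : ℕ} (hlevel : σ.reg .level = l) (hl : 0 < l) (hzero : σ.vec 0 1 = 0)
    (hQ : ∀ σ' y, AgreesOff {.iter} (σ.setVec 0 1 y) σ' →
      IsSecondAxis (fun j => σ.vec l (j + 1)) (σ.reg .count) (σ.vec 0 0) y → Q σ') :
    HaltsWithin findSecondAxis σ (σ.reg .count * 7 + 1) Q := by
  subst hlevel
  let Inv (k : ℕ) (σ' : State L) : Prop := ∃ y, AgreesOff {.iter} (σ.setVec 0 1 y) σ' ∧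
    IsSecondAxis (fun j => σ.vec (σ.reg .level) (j + 1)) k (σ.vec 0 0) y
  refine forReg Inv ⟨0, ?_, .inl ⟨rfl, by simp⟩⟩ ?_ ?_ ?_
  · rw [← hzero, State.setVec_vec_self]
    exact .refl _ _
  · rintro k σ' ⟨y, hσ', -⟩
    simp [IntTerm.value, hσ'.reg .count]
  · rintro k σ' - ⟨y, hσ', hy⟩
    have hvec : σ'.vec = (σ.setVec 0 1 y).vec := hσ'.vec
    have hlev : σ'.reg .level = σ.reg .level := hσ'.reg .level (by simp)
    refine cons (dot trivial trivial (ite (q := 3) (r := 1) (fun hle => ?_) fun hpos => skip ?_))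
    · have hy0 : y = 0 := by
        simpa [Cond.Holds, RealTerm.value, VecTerm.value, IntTerm.value, hvec,
          dotProduct_self_nonpos] using hle
      refine project fun f => ⟨by simp, orthComp (σ.vec (σ.reg .level) (k + 1)) (σ.vec 0 0), ?_, ?_⟩
      · have hset := ((hσ'.setReg rfl k).withScalar f).setVec 0 1
          (orthComp (σ.vec (σ.reg .level) (k + 1)) (σ.vec 0 0))
        simpa [IntTerm.value, hvec, hlev, State.setVec_setVec, hl.ne'] using hset
      · rcases eq_or_ne (orthComp (σ.vec (σ.reg .level) (k + 1)) (σ.vec 0 0)) 0 with hc | hc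
        · rcases hy with ⟨-, hy⟩ | ⟨hy, -⟩
          · exact .inl ⟨hc, Nat.forall_lt_succ_right.2 ⟨hy, hc⟩⟩
          · exact absurd hy0 hy
        · exact .inr ⟨hc, k, k.lt_succ_self, rfl⟩
    · have hy0 : y ≠ 0 := by
        simpa [Cond.Holds, RealTerm.value, VecTerm.value, IntTerm.value, hvec,
          dotProduct_self_nonpos] using hpos
      refine ⟨by simp, y, (hσ'.setReg rfl _).withScalar _, ?_⟩
      rcases hy with ⟨hy, -⟩ | ⟨-, j, hj, hy⟩
      · exact absurd hy hy0
      · exact .inr ⟨hy0, j, hj.trans k.lt_succ_self, hy⟩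
  · rintro σ' ⟨y, hσ', hy⟩
    exact hQ _ y (hσ'.setReg (by simp) _) hy

theorem searchPlane {l m : ℕ} {V : Submodule ℝ (Fin L.numVars → ℝ)} (hl : 0 < l)
    (hlevel : σ.reg .level = l) (hstatus : σ.reg .status = 1) (hcount : σ.reg .count = m)
    (hcursor : σ.cursor l = m) (hx : σ.vec 0 0 = σ.vec l 1) (hy : σ.vec 0 1 = 0) (hm : 0 < m)
    (h0 : σ.vec l 1 ≠ 0) (hV : Module.finrank ℝ V ≤ 2) (hmem : ∀ j < m, σ.vec l (j + 1) ∈ V) :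
    HaltsWithin searchPlane σ (m * 7 + 1 + 30 * (m + 1)) (Outcome l m σ) := by
  subst hcount
  refine seq (findSecondAxis hlevel hl hy fun σ' y hσ' haxis => ?_)
  have hlevel' : σ'.reg .level = l := (hσ'.reg .level (by simp)).trans hlevel
  have hcount' : σ'.reg .count = σ.reg .count := hσ'.reg .count (by simp)
  have hpres : Preserves l σ σ' :=
    ⟨hσ'.reg .point (by simp), hσ'.flag, fun _ _ => congrFun hσ'.cursor _,
      fun _ => by simp [hσ'.vec, hl.ne'], fun k hk => by simp [hσ'.vec, (hl.trans hk).ne']⟩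
  have hline : σ'.vec 0 0 = σ.vec l 1 ∧ σ'.vec 0 1 = y := by simp [hσ'.vec, hx]
  rw [hx] at haxis
  refine mono_time (searchLine (fun σ'' hσ'' hno => .infeasible (hpres.failed hσ'')
    fun hfeas => hno ?_) fun σ'' w hσ'' hvec hw => ?_) (by rw [hcount'])
  · simp only [hcount', hline, State.system, hlevel', hpres.constraint]
    exact hfeas.exists_line (haxis.inPlane hV hmem hm h0)
  · rw [hlevel'] at hvec
    rw [hcount'] at hw
    simp only [State.system, hlevel'] at hw
    exact .solved (hpres.trans (.of_sameControl hσ'' hvec)) (.of_sameControl hlevel'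
      ((hσ'.reg .status (by simp)).trans hstatus) ((congrFun hσ'.cursor l).trans hcursor) hσ''
      hvec hw)

theorem plane {l m : ℕ} {V : Submodule ℝ (Fin L.numVars → ℝ)} (hl : 0 < l) (hσ : Solved l 0 σ)
    (hm : σ.cursor (l + 1) = m) (hm0 : 0 < m) (hV : Module.finrank ℝ V ≤ 2)
    (hmem : ∀ j < m, σ.vec l (j + 1) ∈ V) : HaltsWithin plane σ (50 * (m + 1)) (Outcome l m σ) := by
  have hsearch (σ' : State L) (hpres : Preserves l σ σ') (hlevel : σ'.reg .level = l)
      (hstatus : σ'.reg .status = 1) (hcount : σ'.reg .count = m) (hcursor : σ'.cursor l = m)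
      (hx : σ'.vec 0 0 = σ'.vec l 1) (hy : σ'.vec 0 1 = 0) (h0 : σ.vec l 1 ≠ 0) :
      HaltsWithin RealRAM.searchPlane σ' (m * 7 + 1 + 30 * (m + 1)) (Outcome l m σ) := by
    rw [← hpres.constraint 0] at h0
    simp only [← hpres.constraint] at hmem
    exact (searchPlane hl hlevel hstatus hcount hcursor hx hy hm0 h0 hV hmem).mono le_rfl
      fun _ => hpres.outcome
  refine mono_time (q := 1 + (m * 7 + 1 + 30 * (m + 1) + 1 + 1 + 1) + 1 + 1 + 1) (cons (setReg (cons
    (dot trivial trivial (ite (fun hle => ?_) fun hpos => ?_))))) (by omega)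
  · have h0 : σ.vec l 1 = 0 := by
      simpa [Cond.Holds, RealTerm.value, VecTerm.value, IntTerm.value, hσ.level,
          dotProduct_self_nonpos] using hle
    exact setReg (.infeasible ⟨by simp, by simp [IntTerm.value], rfl⟩
      (not_feasible_of_eq_zero hm0 h0))
  · have h0 : σ.vec l 1 ≠ 0 := by
      simpa [Cond.Holds, RealTerm.value, VecTerm.value, IntTerm.value, hσ.level,
          dotProduct_self_nonpos] using hpos
    refine cons (setVec trivial (cons (setVec trivial (cons (setCursor (hsearch _ ?_ ?_ ?_ ?_ ?_
      ?_ ?_ h0))))))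
    · exact ⟨by simp, by simp, fun k hk => by simp [IntTerm.value, hσ.level, hk.ne'],
        fun j => by simp [IntTerm.value, hl.ne'],
        fun k hk => by simp [IntTerm.value, (hl.trans hk).ne']⟩
    all_goals simp [VecTerm.value, IntTerm.value, hσ.level, hσ.status, hm, hl.ne']

theorem lift {l i : ℕ} (hl : 0 < l) (hσ : Solved l i σ) (hcursor : σ.cursor (l + 1) = i)
    (h0 : σ.vec (l + 1) (i + 1) ≠ 0)
    (hproj : ∀ j < i,
      σ.vec l (j + 1) = orthComp (σ.vec (l + 1) (j + 1)) (σ.vec (l + 1) (i + 1))) :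
    HaltsWithin lift σ (50 * (i + 2))
      fun σ' => Preserves (l + 1) σ σ' ∧ Solved (l + 1) (i + 1) σ' := by
  have hsearch (σ' : State L) (hpres : Preserves (l + 1) σ σ') (hlevel : σ'.reg .level = l + 1)
      (hstatus : σ'.reg .status = 1) (hcount : σ'.reg .count = i + 1)
      (hcur : σ'.cursor (l + 1) = i + 1)
      (hx : σ'.vec 0 0 = orthComp (σ.vec l 0) (σ.vec (l + 1) (i + 1)))
      (hy : σ'.vec 0 1 = σ.vec (l + 1) (i + 1)) :
      HaltsWithin RealRAM.searchLine σ' (30 * (i + 2))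
        fun σ'' => Preserves (l + 1) σ σ'' ∧ Solved (l + 1) (i + 1) σ'' := by
    have hsystem : ∀ j, σ'.system j = σ.vec (l + 1) (j + 1) := fun j => by
      rw [State.system, hlevel, hpres.constraint]
    have hpos : ∀ j < i, 0 < σ.vec l 0 ⬝ᵥ
        orthComp (σ.vec (l + 1) (j + 1)) (σ.vec (l + 1) (i + 1)) := fun j hj => by
      rw [← hproj j hj]
      exact hσ.pos j hj
    refine mono_time (searchLine (fun σ'' _ hno => absurd ?_ hno) fun σ'' w hsame hvec hw => ?_)
      (by rw [hcount])
    · simpa only [hsystem, hx, hy, hcount] using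
        exists_lift (a := fun j => σ.vec (l + 1) (j + 1)) h0 hpos
    · rw [hlevel] at hvec
      simp only [hcount, hsystem, ← hpres.constraint] at hw
      exact ⟨hpres.trans (.of_sameControl hsame hvec),
        .of_sameControl hlevel hstatus hcur hsame hvec hw⟩
  refine mono_time (q := 3 + (30 * (i + 2) + 1 + 1 + 1) + 1) (cons (setReg (seq (project fun f =>
    cons (setVec trivial (cons (setCursor (cons (setReg (hsearch _ ?_ ?_ ?_ ?_ ?_ ?_ ?_))))))))))
    (by omega)
  · exact ⟨by simp, by simp, fun k hk => by simp [IntTerm.value, hσ.level, hk.ne'],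
        fun j => by simp [IntTerm.value, hl.ne'],
        fun k hk => by simp [IntTerm.value, ((Nat.succ_pos l).trans hk).ne']⟩
  all_goals simp [VecTerm.value, IntTerm.value, hσ.level, hσ.status, hcursor]

theorem descend {l i : ℕ} (hlevel : σ.reg .level = l + 1) (hstatus : σ.reg .status = 1)
    (hcursor : σ.cursor (l + 1) = i) :
    HaltsWithin descend σ (4 * i + 3) (Descended l i σ) := by
  let Inv (k : ℕ) (σ' : State L) : Prop := AgreesOff {.iter} { σ with vec := σ'.vec } σ' ∧
    (∀ l' > l, σ'.vec l' = σ.vec l') ∧ ∀ j < k,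
      σ'.vec l (j + 1) = orthComp (σ.vec (l + 1) (j + 1)) (σ.vec (l + 1) (i + 1))
  refine mono_time (q := i * 4 + 1 + (1 + 1)) (seq (forReg Inv ⟨.refl _ _, fun _ _ => rfl, by simp⟩
    (fun k σ' ⟨hσ', _⟩ => ?_) (fun k σ' _ ⟨hσ', hvec, hproj⟩ => project fun f => ⟨?_, ?_, ?_, ?_⟩)
    fun σ' ⟨hσ', hvec, hproj⟩ => cons (setReg (setCursor
      ⟨?_, ⟨?_, ?_, ?_, by simp⟩, ?_, hproj⟩)))) (by omega)
  · simp [IntTerm.value, hσ'.reg .level, hσ'.cursor, hlevel, hcursor]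
  · simp
  · exact ⟨fun r hr => by simpa [Function.update_of_ne hr] using hσ'.reg r hr, hσ'.cursor,
      hσ'.flag, rfl⟩
  · intro l' hl'
    simp [IntTerm.value, hσ'.reg .level, hlevel, hl'.ne', hvec l' hl']
  · refine Nat.forall_lt_succ_right.2 ⟨fun j hj => ?_, ?_⟩
    · simp [IntTerm.value, hσ'.reg .level, hlevel, hj.ne, hproj j hj]
    · simp [IntTerm.value, hσ'.reg .level, hσ'.cursor, hlevel, hcursor, hvec]
  · refine ⟨by simp [hσ'.reg .point], hσ'.flag, fun k hk => ?_, fun j => ?_, fun k hk => ?_⟩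
    · simp [IntTerm.value, hσ'.reg .level, hσ'.cursor, hlevel, (l.lt_succ_self.trans hk).ne']
    · simp [hvec]
    · simp [hvec k (l.lt_succ_self.trans hk)]
  all_goals
    simp [IntTerm.value, hσ'.reg .level, hσ'.reg .status, hσ'.cursor, hlevel, hstatus, hcursor]

theorem advance {l i : ℕ} (hσ : Solved (l + 1) i σ)
    (hzero : σ.vec (l + 1) (i + 1) = 0 → ∀ σ', Failed σ σ' → Q σ')
    (hpos : ∀ σ', Preserves (l + 1) σ σ' → Solved (l + 1) (i + 1) σ' → Q σ')
    (hneg : σ.vec (l + 1) (i + 1) ≠ 0 → ¬ 0 < σ.vec (l + 1) 0 ⬝ᵥ σ.vec (l + 1) (i + 1) →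
      ∀ σ', Descended l i σ σ' → Q σ') :
    HaltsWithin advance σ (20 * (i + 1)) Q := by
  refine mono_time (q := (1 + (4 * i + 3) + 1 + 1) + 1 + 1 + 1) (cons (dot trivial trivial
    (ite (fun hle => cons (dot trivial trivial (ite (fun hle' => setReg ?_) fun hgt' => ?_)))
    fun hgt => setCursor (hpos _ ?_ ⟨?_, ?_, ?_, ?_⟩)))) (by omega)
  · refine hzero ?_ _ ⟨by simp, by simp [IntTerm.value], rfl⟩
    simpa [Cond.Holds, RealTerm.value, VecTerm.value, IntTerm.value, hσ.level, hσ.cursor,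
      dotProduct_self_nonpos] using hle'
  · have h0 : σ.vec (l + 1) (i + 1) ≠ 0 := by
      simpa [Cond.Holds, RealTerm.value, VecTerm.value, IntTerm.value, hσ.level, hσ.cursor,
        dotProduct_self_nonpos] using hgt'
    have hnpos : ¬ 0 < σ.vec (l + 1) 0 ⬝ᵥ σ.vec (l + 1) (i + 1) := by
      simpa [Cond.Holds, RealTerm.value, VecTerm.value, IntTerm.value, hσ.level, hσ.cursor]
        using hle
    refine mono (descend (l := l) ?_ ?_ ?_) le_rfl fun σ' h => hneg h0 hnpos σ' ?_
    exacts [hσ.level, hσ.status, hσ.cursor,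
      ⟨(Preserves.withScalar _ σ _).trans h.preserves, h.solved, h.cursor, h.proj⟩]
  · exact ⟨rfl, rfl, fun k hk => by simp [IntTerm.value, hσ.level, hk.ne'], fun _ => rfl,
      fun _ _ => rfl⟩
  · exact hσ.level
  · exact hσ.status
  · simp [IntTerm.value, hσ.level, hσ.cursor]
  · refine Nat.forall_lt_succ_right.2 ⟨hσ.pos, ?_⟩
    simpa [Cond.Holds, RealTerm.value, VecTerm.value, IntTerm.value, hσ.level, hσ.cursor] using hgt

end HaltsWithin

/-! ### The main loop of the solver -/

/-- Treat the next constraint of the current level, or leave the level if there is none. -/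
def solveStep : Prog :=
  .ite (Cond.ile (.cursor (.add (.reg .level) (.const 1))) (.cursor (.reg .level))).compile
    (.ite (Cond.ile .topLevel (.reg .level)).compile (setReg .status (.const 2)) lift)
    (.ite (Cond.ile (.reg .level) (.const 2)).compile plane advance)

/-- Solve the system of the current level, which is the top level. The register `status` is `1`
during the search, and in the end it is `2` or `0` according as there is a solution or not. -/
def solveLoop : Prog :=
  .loop (Cond.and (.ile (.const 1) (.reg .status)) (.ile (.reg .status) (.const 1))).compile
    solveStep

/-- A bound for the time to solve `m` constraints in dimension `d + 2`: in the worst case, each of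
them requires to solve the projected system of its predecessors in one dimension less. -/
def solveTime : ℕ → ℕ → ℕ
  | 0, m => 200 * (m + 1)
  | d + 1, m => ∑ j ∈ Finset.range m, (solveTime d j + 200 * (j + 1))

/-- Running `solveLoop` from `σ` on, a state that satisfies `P` is reached within `q` units of
time. -/
def LeadsTo (σ : State L) (q : ℕ) (P : State L → Prop) : Prop :=
  ∀ r Q, (∀ σ', P σ' → HaltsWithin solveLoop σ' r Q) → HaltsWithin solveLoop σ (q + r) Q

namespace LeadsTo

variable {σ : State L} {q q' : ℕ} {P P' : State L → Prop}

theorem of_holds (h : P σ) : LeadsTo σ q P := fun _ _ hP => (hP σ h).mono_time (by omega)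

theorem bind (h : LeadsTo σ q P) (h' : ∀ σ', P σ' → LeadsTo σ' q' P') : LeadsTo σ (q + q') P' :=
  fun r Q hP' => add_assoc q q' r ▸ h _ Q fun σ' hσ' => h' σ' hσ' r Q hP'

theorem mono (h : LeadsTo σ q P) (hq : q ≤ q') (hP : ∀ σ', P σ' → P' σ') : LeadsTo σ q' P' :=
  fun r Q hP' => (h r Q fun σ' hσ' => hP' σ' (hP σ' hσ')).mono_time (by omega)

theorem of_solveStep (hstatus : σ.reg .status = 1) (h : HaltsWithin solveStep σ q P) :
    LeadsTo σ (q + 1) P := fun r Q hP =>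
  HaltsWithin.mono_time (HaltsWithin.loop_true (by simp [Cond.Holds, IntTerm.value, hstatus])
    (h.mono le_rfl hP)) (by omega)

theorem of_lift {l i : ℕ} (hσ : Solved l i σ) (hcursor : σ.cursor (l + 1) = i)
    (hl : l < L.topLevel) (h : HaltsWithin lift σ q P) : LeadsTo σ (q + 5) P := by
  refine mono (of_solveStep (q := (1 + q + 1) + 1 + 1) hσ.status (.ite (fun _ => .ite
    (fun htop => ?_) fun _ => h) fun hlt => ?_)) (by omega) fun _ => id
  · exact absurd htop (by simpa [Cond.Holds, IntTerm.value, hσ.level] using hl)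
  · simp [Cond.Holds, IntTerm.value, hσ.level, hσ.cursor, hcursor] at hlt

theorem of_plane (hσ : Solved 2 0 σ) (hcursor : 0 < σ.cursor 3) (h : HaltsWithin plane σ q P) :
    LeadsTo σ (q + 5) P := by
  refine mono (of_solveStep (q := 1 + (q + 1 + 1) + 1) hσ.status (.ite (fun hle => ?_) fun _ =>
    .ite (fun _ => h) fun hlevel => ?_)) (by omega) fun _ => id
  · simp [Cond.Holds, IntTerm.value, hσ.level, hσ.cursor, hcursor.ne'] at hle
  · simp [Cond.Holds, IntTerm.value, hσ.level] at hlevel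

theorem of_advance {l i : ℕ} (hσ : Solved l i σ) (hl : 2 < l) (hi : i < σ.cursor (l + 1))
    (h : HaltsWithin advance σ q P) : LeadsTo σ (q + 5) P := by
  refine mono (of_solveStep (q := 1 + (1 + q + 1) + 1) hσ.status (.ite (fun hle => ?_) fun _ =>
    .ite (fun hlevel => ?_) fun _ => h)) (by omega) fun _ => id
  · simp [Cond.Holds, IntTerm.value, hσ.level, hσ.cursor, hi.not_ge] at hle
  · simp [Cond.Holds, IntTerm.value, hσ.level, hl.not_ge] at hlevel

theorem outcome_succ {l i q : ℕ} (hl : 2 ≤ l) (htop : l < L.topLevel) (hσ : Solved (l + 1) i σ)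
    (hi : i < σ.cursor (l + 2))
    (hsub : σ.vec (l + 1) (i + 1) ≠ 0 → ∀ σ', Descended l i σ σ' → LeadsTo σ' q (Outcome l i σ')) :
    LeadsTo σ (q + 200 * (i + 1)) (Outcome (l + 1) (i + 1) σ) := by
  refine mono (bind (q := 20 * (i + 1) + 5) (q' := q + (50 * (i + 2) + 5))
    (P := fun σ' => Outcome (l + 1) (i + 1) σ σ' ∨ σ.vec (l + 1) (i + 1) ≠ 0 ∧
      ¬ 0 < σ.vec (l + 1) 0 ⬝ᵥ σ.vec (l + 1) (i + 1) ∧ Descended l i σ σ')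
    (of_advance hσ (by omega) hi (.advance hσ ?_ ?_ ?_)) ?_) (by omega) fun _ => id
  · exact fun hzero σ' hσ' => .inl (.infeasible hσ' (not_feasible_of_eq_zero i.lt_succ_self hzero))
  · exact fun σ' hpres hsolved => .inl (.solved hpres hsolved)
  · exact fun h0 hneg σ' hσ' => .inr ⟨h0, hneg, hσ'⟩
  · rintro σ' (hσ' | ⟨h0, hneg, hσ'⟩)
    · exact of_holds hσ'
    refine bind (hsub h0 σ' hσ') fun σ'' hσ'' => ?_
    rcases hσ'' with ⟨hfail, hno⟩ | ⟨hpres, hsolved⟩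
    · refine of_holds (.infeasible (hσ'.preserves.failed hfail) fun hfeas => hno ?_)
      exact (hfeas.project hσ.pos hneg).imp fun w hw j hj => by
        simpa only [hσ'.proj j hj] using hw j hj
    · have hpres' := hσ'.preserves.trans (hpres.mono l.lt_succ_self)
      have hcursor : σ''.cursor (l + 1) = i := (hpres.cursor _ l.lt_succ_self).trans hσ'.cursor
      refine mono (of_lift hsolved hcursor htop (.lift (by omega) hsolved hcursor ?_
        fun j hj => ?_)) le_rfl fun σ₃ ⟨hpres₃, hsolved₃⟩ => .solved (hpres'.trans hpres₃) hsolved₃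
      · rwa [hpres'.constraint]
      · rw [hpres.constraint, hσ'.proj j hj, hpres'.constraint, hpres'.constraint]

end LeadsTo

theorem leadsTo_outcome (d : ℕ) {σ : State L} {m : ℕ} {V : Submodule ℝ (Fin L.numVars → ℝ)}
    (htop : d + 2 ≤ L.topLevel) (hV : Module.finrank ℝ V ≤ d + 2) (hm : σ.cursor (d + 3) = m)
    (hmem : ∀ j < m, σ.vec (d + 2) (j + 1) ∈ V) (hσ : Solved (d + 2) 0 σ) :
    LeadsTo σ (solveTime d m) (Outcome (d + 2) m σ) := by
  induction d generalizing σ m V with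
  | zero =>
    rcases m.eq_zero_or_pos with rfl | hm0
    · exact .of_holds (.solved (.refl _ _) hσ)
    exact (LeadsTo.of_plane hσ (hm ▸ hm0) (.plane two_pos hσ hm hm0 hV hmem)).mono
      (by simp only [solveTime]; omega) fun _ => id
  | succ d ih =>
    suffices h : ∀ i ≤ m, LeadsTo σ (∑ j ∈ Finset.range i, (solveTime d j + 200 * (j + 1)))
      (Outcome (d + 3) i σ) from h m le_rfl
    intro i hi
    induction i with
    | zero => exact .of_holds (.solved (.refl _ _) hσ)
    | succ i ihi =>
      rw [Finset.sum_range_succ]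
      refine (ihi (by omega)).bind fun σ' hσ' => ?_
      rcases hσ' with ⟨hfail, hno⟩ | ⟨hpres, hsolved⟩
      · exact .of_holds (.infeasible hfail fun hfeas => hno (hfeas.mono i.le_succ))
      refine LeadsTo.mono (.outcome_succ (l := d + 2) (by omega) htop hsolved ?_
        fun h0 σ'' hσ'' => ?_) le_rfl fun _ => hpres.outcome
      · rw [hpres.cursor _ (d + 3).lt_succ_self, hm]
        exact hi
      · rw [hpres.constraint] at h0
        refine ih (V := V ⊓ orthSpace (σ.vec (d + 3) (i + 1))) (by omega)
          (finrank_inf_orthSpace_le hV h0 (hmem i hi)) hσ''.cursor (fun j hj => ?_) hσ''.solved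
        rw [hσ''.proj j hj, hpres.constraint, hpres.constraint]
        exact orthComp_mem_inf_orthSpace h0 (hmem i hi) (hmem j (by omega))

theorem two_mul_sum_pow_le (k m : ℕ) :
    2 * ∑ j ∈ Finset.range m, (j + 1) ^ (k + 1) ≤ (m + 1) ^ (k + 2) := by
  induction m with
  | zero => simp
  | succ m ih =>
    calc 2 * ∑ j ∈ Finset.range (m + 1), (j + 1) ^ (k + 1)
      _ = 2 * ∑ j ∈ Finset.range m, (j + 1) ^ (k + 1) + 2 * (m + 1) ^ (k + 1) := by
        rw [Finset.sum_range_succ, mul_add]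
      _ ≤ (m + 1) ^ (k + 2) + 2 * (m + 1) ^ (k + 1) := by gcongr
      _ = (m + 1) ^ k * ((m + 1) * (m + 3)) := by ring
      _ ≤ (m + 2) ^ k * ((m + 2) * (m + 2)) := Nat.mul_le_mul (by gcongr; omega) (by nlinarith)
      _ = (m + 1 + 1) ^ (k + 2) := by ring

theorem solveTime_le (d m : ℕ) : solveTime d m ≤ 400 * (m + 1) ^ (d + 1) := by
  induction d generalizing m with
  | zero => simp only [solveTime, zero_add, pow_one]; omega
  | succ d ih =>
    calc solveTime (d + 1) m
      _ ≤ ∑ j ∈ Finset.range m, 800 * (j + 1) ^ (d + 1) := Finset.sum_le_sum fun j _ => by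
        have := ih j
        have : j + 1 ≤ (j + 1) ^ (d + 1) := Nat.le_self_pow d.succ_ne_zero _
        omega
      _ = 400 * (2 * ∑ j ∈ Finset.range m, (j + 1) ^ (d + 1)) := by rw [← Finset.mul_sum]; ring
      _ ≤ 400 * (m + 1) ^ (d + 2) := Nat.mul_le_mul_left _ (two_mul_sum_pow_le d m)

theorem HaltsWithin.solveLoop {σ : State L} {m : ℕ} {Q : State L → Prop}
    (hσ : Solved L.topLevel 0 σ) (hm : σ.cursor (L.topLevel + 1) = m)
    (h : ∀ σ', σ'.reg .point = σ.reg .point → σ'.flag = σ.flag →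
      (σ'.reg .status ≠ 0 ↔ Feasible (fun j => σ.vec L.topLevel (j + 1)) m) → Q σ') :
    HaltsWithin solveLoop σ (solveTime (L.topLevel - 2) m + 5) Q := by
  obtain ⟨d, hd⟩ : ∃ d, L.topLevel = d + 2 := ⟨L.topLevel - 2, by unfold Layout.topLevel; omega⟩
  have hrank : Module.finrank ℝ (⊤ : Submodule ℝ (Fin L.numVars → ℝ)) ≤ d + 2 := by
    rw [finrank_top, Module.finrank_fin_fun, ← hd]
    exact le_max_right _ _
  rw [hd] at hσ hm h ⊢
  refine leadsTo_outcome d hd.ge hrank hm (fun _ _ => Submodule.mem_top) hσ 5 Q ?_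
  have exit (σ' : State L) (hpoint : σ'.reg .point = σ.reg .point) (hflag : σ'.flag = σ.flag)
      (hstatus : σ'.reg .status ≠ 1)
      (hfeas : σ'.reg .status ≠ 0 ↔ Feasible (fun j => σ.vec (d + 2) (j + 1)) m) :
      HaltsWithin RealRAM.solveLoop σ' 1 Q :=
    loop_false (by simp only [Cond.Holds, IntTerm.value]; omega) (h σ' hpoint hflag hfeas)
  rintro σ' (⟨hfail, hno⟩ | ⟨hpres, hsolved⟩)
  · exact (exit σ' hfail.point hfail.flag (by simp [hfail.status])
      (by simp [hfail.status, hno])).mono_time (by omega)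
  · have hfeas : Feasible (fun j => σ.vec (d + 2) (j + 1)) m :=
      ⟨_, fun j hj => hpres.constraint j ▸ hsolved.pos j hj⟩
    have hcursor : σ'.cursor (d + 3) = m := (hpres.cursor _ (d + 2).lt_succ_self).trans hm
    have hstep : HaltsWithin solveStep σ' 3 (· = σ'.setReg .status 2) := by
      refine mono_time (q := (1 + 0 + 1) + 0 + 1) (ite (fun _ => ite (fun _ => setReg rfl)
        fun hlevel => ?_) fun hcount => ?_) le_rfl
      · simp [Cond.Holds, IntTerm.value, hsolved.level, hd] at hlevel
      · simp [Cond.Holds, IntTerm.value, hsolved.level, hsolved.cursor, hcursor] at hcount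
    refine LeadsTo.of_solveStep hsolved.status hstep 1 Q fun τ hτ => ?_
    rw [hτ]
    exact exit _ (by simpa using hpres.point) (by simpa using hpres.flag) (by simp)
      (by simp [hfeas])

/-! ### Finding the vertices -/

/-- The differences of the other input points to the point `p`. -/
def Layout.diff (L : Layout) (p j : ℕ) : Fin L.numVars → ℝ :=
  L.point (if j < p then j else j + 1) - L.point p

/-- Write the constraints that say that `point` is a vertex to the top level. The number of the
`iter`-th of the other points is expressed by truncated subtractions. -/
def buildSystem : Prog :=
  forReg .iter (.sub .numTerms (.const 1))
    (setVec .topLevel (.add (.reg .iter) (.const 1))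
      (.sub (.point (.add (.reg .iter) (.sub (.const 1) (.sub (.reg .point) (.reg .iter)))))
        (.point (.reg .point))))

/-- Put into the flag of `point` whether it is a vertex. -/
def vertexTest : Prog :=
  .seq buildSystem
    (.seq (setCursor (.add .topLevel (.const 1)) (.sub .numTerms (.const 1)))
      (.seq (setCursor .topLevel (.const 0))
        (.seq (setReg .level .topLevel)
          (.seq (setReg .status (.const 1))
            (.seq solveLoop (setFlag (.reg .point) (.reg .status)))))))

/-- Put into the flags which of the input points are vertices. -/
def findVertices : Prog := forReg .point .numTerms vertexTest

namespace HaltsWithin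

variable {σ : State L} {Q : State L → Prop}

theorem buildSystem {p : ℕ} (hp : p < L.numTerms) (hpoint : σ.reg .point = p)
    (h : ∀ σ' : State L, σ'.reg .point = p → σ'.flag = σ.flag →
      (∀ j < L.numTerms - 1, σ'.vec L.topLevel (j + 1) = L.diff p j) → Q σ') :
    HaltsWithin RealRAM.buildSystem σ (2 * L.numTerms) Q := by
  refine mono_time (q := (L.numTerms - 1) * (1 + 1) + 1) (forReg (fun i σ' =>
    σ'.reg .point = p ∧ σ'.flag = σ.flag ∧ ∀ j < i, σ'.vec L.topLevel (j + 1) = L.diff p j)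
    ⟨hpoint, rfl, by simp⟩ (fun _ _ _ => rfl) ?_ fun σ' ⟨hpoint', hflag, hvec⟩ => ?_) (by omega)
  · rintro i σ' hi ⟨hpoint', hflag, hvec⟩
    have hindex : i + (1 - (p - i)) = if i < p then i else i + 1 := by split <;> omega
    refine setVec ⟨?_, ?_⟩ ⟨by simp, by simpa using hpoint', hflag, fun j hj => ?_⟩
    · simp only [VecTerm.Valid, IntTerm.value, State.setReg_reg, Function.update_self, ne_eq,
        reduceCtorEq, not_false_eq_true, Function.update_of_ne, hpoint', hindex]
      split <;> omega
    · simpa [VecTerm.Valid, IntTerm.value, hpoint'] using hp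
    · rcases Nat.lt_succ_iff_lt_or_eq.1 hj with hj | rfl
      · simpa [IntTerm.value, hj.ne] using hvec j hj
      · simp [IntTerm.value, VecTerm.value, hpoint', hindex, Layout.diff]
  · exact h _ (by simpa using hpoint') hflag hvec

theorem vertexTest {p : ℕ} (hp : p < L.numTerms) (hpoint : σ.reg .point = p)
    (h : ∀ σ' : State L, σ'.reg .point = p → (∀ q ≠ p, σ'.flag q = σ.flag q) →
      (σ'.flag p ≠ 0 ↔ Feasible (L.diff p) (L.numTerms - 1)) → Q σ') :
    HaltsWithin RealRAM.vertexTest σ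
      (solveTime (L.topLevel - 2) (L.numTerms - 1) + 15 * L.numTerms) Q := by
  have solve (τ : State L) (hτ : Solved L.topLevel 0 τ)
      (hcount : τ.cursor (L.topLevel + 1) = L.numTerms - 1) (hpoint : τ.reg .point = p)
      (hflag : τ.flag = σ.flag)
      (hvec : ∀ j < L.numTerms - 1, τ.vec L.topLevel (j + 1) = L.diff p j) :
      HaltsWithin (.seq RealRAM.solveLoop (RealRAM.setFlag (.reg .point) (.reg .status))) τ
        (solveTime (L.topLevel - 2) (L.numTerms - 1) + 5 + 1) Q := by
    refine seq (solveLoop hτ hcount fun σ' hpoint' hflag' hfeas => setFlag (h _ ?_ ?_ ?_))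
    · simpa using hpoint'.trans hpoint
    · intro q hq
      simp [IntTerm.value, hpoint', hpoint, hq, hflag', hflag]
    · simp only [IntTerm.value, State.setFlag_flag, hpoint', hpoint, Function.update_self, hfeas]
      exact exists_congr fun w => forall₂_congr fun j hj => by simp only [hvec j hj]
  refine mono_time (q := 2 * L.numTerms +
    (solveTime (L.topLevel - 2) (L.numTerms - 1) + 5 + 1 + 1 + 1 + 1 + 1))
    (seq (buildSystem hp hpoint fun σ' hpoint' hflag hvec =>
      cons (setCursor (cons (setCursor (cons (setReg (cons (setReg
        (solve _ ⟨?_, ?_, ?_, ?_⟩ ?_ ?_ hflag hvec)))))))))) (by omega)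
  all_goals simp [IntTerm.value, hpoint']

theorem findVertices
    (h : ∀ σ' : State L,
      (∀ p < L.numTerms, σ'.flag p ≠ 0 ↔ Feasible (L.diff p) (L.numTerms - 1)) → Q σ') :
    HaltsWithin RealRAM.findVertices σ
      (L.numTerms * (solveTime (L.topLevel - 2) (L.numTerms - 1) + 15 * L.numTerms + 1) + 1) Q :=
  forReg (fun i σ' => ∀ p < i, σ'.flag p ≠ 0 ↔ Feasible (L.diff p) (L.numTerms - 1)) (by simp)
    (fun _ _ _ => rfl) (fun i σ' hi hflag => vertexTest hi (by simp)
      fun σ'' hpoint hother hfeas => ⟨hpoint, fun p hp => by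
        rcases Nat.lt_succ_iff_lt_or_eq.1 hp with hp | rfl
        · rw [hother p hp.ne]
          exact hflag p hp
        · exact hfeas⟩) fun σ' hflag => h _ hflag

end HaltsWithin

/-! ### Finding the minimal vertices -/

/-- Clear `isMinimal` if `iter` is a vertex other than `point` and below it. -/
def compare : Prog :=
  .ite (Cond.and (.ile (.const 1) (.flag (.reg .iter)))
      (.not (.and (.ile (.reg .iter) (.reg .point)) (.ile (.reg .point) (.reg .iter))))).compile
    (.seq (allNonneg .dominates (.sub (.point (.reg .point)) (.point (.reg .iter))))
      (.ite (Cond.ile (.const 1) (.reg .dominates)).compile (setReg .isMinimal (.const 0)) .skip))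
    .skip

/-- Put into `isMinimal` whether `point` is a minimal vertex. -/
def testMinimal : Prog :=
  .seq (setReg .isMinimal (.flag (.reg .point))) (forReg .iter .numTerms compare)

/-- Put into the cursors, which the solver does not need any more, which of the input points are
minimal vertices. -/
def findMinimal : Prog :=
  forReg .point .numTerms (.seq testMinimal (setCursor (.reg .point) (.reg .isMinimal)))

/-- The input point `p` is minimal among those that satisfy `V`. -/
def Layout.IsMinimal (L : Layout) (V : ℕ → Prop) (p : ℕ) : Prop :=
  V p ∧ ∀ q < L.numTerms, V q → q ≠ p → ¬ L.point q ≤ L.point p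

namespace HaltsWithin

variable {σ : State L} {Q : State L → Prop}

theorem compare {p q : ℕ} (hp : p < L.numTerms) (hq : q < L.numTerms) (hpoint : σ.reg .point = p)
    (hiter : σ.reg .iter = q)
    (h : ∀ σ' : State L, σ'.reg .point = p → σ'.reg .iter = q → σ'.flag = σ.flag →
      σ'.cursor = σ.cursor → (σ'.reg .isMinimal ≠ 0 ↔ σ.reg .isMinimal ≠ 0 ∧
        (σ.flag q ≠ 0 → q ≠ p → ¬ L.point q ≤ L.point p)) → Q σ') :
    HaltsWithin RealRAM.compare σ 6 Q := by
  refine mono_time (q := (1 + (1 + 1 + 1)) + 1 + 1) (ite (fun hb => ?_) fun hb => skip ?_) le_rfl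
  · have hother : σ.flag q ≠ 0 ∧ q ≠ p := by
      simp only [Cond.Holds, IntTerm.value, hpoint, hiter] at hb
      omega
    have hvalue : 0 ≤ (VecTerm.sub (.point (.reg .point)) (.point (.reg .iter))).value σ ↔
        L.point q ≤ L.point p := by
      simp only [VecTerm.value, IntTerm.value, hpoint, hiter, sub_nonneg]
    refine seq (allNonneg ⟨by simpa [VecTerm.Valid, IntTerm.value, hpoint] using hp,
      by simpa [VecTerm.Valid, IntTerm.value, hiter] using hq⟩ ?_)
    split_ifs with hle <;> rw [hvalue] at hle
    · exact ite (fun _ => setReg (h _ (by simpa using hpoint) (by simpa using hiter) rfl rfl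
        (by simp [IntTerm.value, hother, hle]))) fun hb' => by
          simp [Cond.Holds, IntTerm.value] at hb'
    · exact ite (fun hb' => by simp [Cond.Holds, IntTerm.value] at hb') fun _ =>
        skip (h _ (by simpa using hpoint) (by simpa using hiter) rfl rfl (by simp [hle]))
  · have hother : σ.flag q ≠ 0 → q = p := by
      simp only [Cond.Holds, IntTerm.value, hpoint, hiter] at hb
      omega
    exact h σ hpoint hiter rfl rfl (by tauto)

theorem testMinimal {p : ℕ} (hp : p < L.numTerms) (hpoint : σ.reg .point = p)
    (h : ∀ σ' : State L, σ'.reg .point = p → σ'.flag = σ.flag → σ'.cursor = σ.cursor →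
      (σ'.reg .isMinimal ≠ 0 ↔ L.IsMinimal (σ.flag · ≠ 0) p) → Q σ') :
    HaltsWithin RealRAM.testMinimal σ (L.numTerms * 7 + 2) Q := by
  refine cons (setReg (forReg (fun i σ' => σ'.reg .point = p ∧ σ'.flag = σ.flag ∧
    σ'.cursor = σ.cursor ∧ (σ'.reg .isMinimal ≠ 0 ↔ σ.flag p ≠ 0 ∧
      ∀ q < i, σ.flag q ≠ 0 → q ≠ p → ¬ L.point q ≤ L.point p))
    ⟨?_, rfl, rfl, by simp [IntTerm.value, hpoint]⟩ (fun _ _ _ => rfl) ?_ ?_))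
  · simpa using hpoint
  · rintro q σ' hq ⟨hpoint', hflag, hcursor, hmin⟩
    refine compare hp hq (by simpa using hpoint') (by simp) fun τ hpoint'' hiter hflag' hcursor'
      hmin' => ⟨hiter, hpoint'', hflag'.trans hflag, hcursor'.trans hcursor, ?_⟩
    rw [hmin', Nat.forall_lt_succ_right, ← and_assoc, ← hmin]
    simp [hflag]
  · rintro σ' ⟨hpoint', hflag, hcursor, hmin⟩
    exact h _ (by simpa using hpoint') hflag hcursor (by simpa [Layout.IsMinimal] using hmin)

theorem findMinimal
    (h : ∀ σ' : State L,
      (∀ p < L.numTerms, σ'.cursor p ≠ 0 ↔ L.IsMinimal (σ.flag · ≠ 0) p) → Q σ') :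
    HaltsWithin RealRAM.findMinimal σ (L.numTerms * (L.numTerms * 7 + 2 + 1 + 1) + 1) Q := by
  refine forReg (fun i σ' => σ'.flag = σ.flag ∧
    ∀ p < i, σ'.cursor p ≠ 0 ↔ L.IsMinimal (σ.flag · ≠ 0) p) ⟨rfl, by simp⟩ (fun _ _ _ => rfl)
    (fun p σ' hp ⟨hflag, hcursor⟩ => seq (r := 1) (testMinimal hp (by simp) ?_))
    fun σ' hσ' => h _ hσ'.2
  refine fun τ hpoint hflag' hcursor' hmin => setCursor ⟨hpoint, hflag'.trans hflag, fun q hq => ?_⟩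
  rcases Nat.lt_succ_iff_lt_or_eq.1 hq with hq | rfl
  · simpa [IntTerm.value, hpoint, hcursor', hq.ne] using hcursor q hq
  · simpa [IntTerm.value, hpoint, hflag] using hmin

end HaltsWithin

/-! ### Writing the output -/

/-- The real cell where the term begins whose number is in the integer cell `c`. -/
def termAddress (c : ℕ) : IExpr := .mul (.load (.const c)) (.add (.load (.const 0)) (.const 1))

/-- Copy the term whose number is in the integer cell `5` to the place given by the cell `4`. -/
def copyTerm : Prog :=
  forLoop 6 (.add (.load (.const 0)) (.const 1))
    (.rstore (.add (termAddress 4) (.load (.const 6)))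
      (.load (.add (termAddress 5) (.load (.const 6)))))

/-- Append the term whose number is in the integer cell `5`, with coefficient `0`, to the output,
whose terms are counted in the cell `4`. -/
def appendTerm : Prog :=
  .seq copyTerm (.seq (.rstore (termAddress 4) (.const 0))
    (.istore (.const 4) (.add (.load (.const 4)) (.const 1))))

/-- Move the terms with a non-zero cursor to the front, with coefficient `0`, and count them. -/
def compact : Prog :=
  .seq (.istore (.const 4) (.const 0))
    (.seq
      (forLoop 5 (.load (.const 1))
        (.ite (.ile (.const 1) (.load (cursorAddress (.load (.const 5))))) appendTerm .skip))
      (.istore (.const 1) (.load (.const 4))))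

theorem mul_succ_add_inj {n j j' k k' : ℕ} (hk : k ≤ n) (hk' : k' ≤ n) :
    j * (n + 1) + k = j' * (n + 1) + k' ↔ j = j' ∧ k = k' := by
  refine ⟨fun h => ?_, fun ⟨hj, hk⟩ => by rw [hj, hk]⟩
  have hkk : k = k' := by
    have := congrArg (· % (n + 1)) h
    simpa [Nat.mod_eq_of_lt (Nat.lt_succ_of_le hk), Nat.mod_eq_of_lt (Nat.lt_succ_of_le hk')]
      using this
  exact ⟨Nat.eq_of_mul_eq_mul_right (by omega : 0 < n + 1) (by omega), hkk⟩

theorem runs_copyTerm {n c i : ℕ} {M : Mem} (hn : M.int 0 = n) (hc : M.int 4 = c)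
    (hi : M.int 5 = i) :
    ∃ t M', Runs copyTerm M t M' ∧ t ≤ 100 * (n + 1) ∧ M'.int = Function.update M.int 6 (n + 1) ∧
      ∀ j, ∀ k ≤ n, M'.real (j * (n + 1) + k) =
        M.real ((if j = c then i else j) * (n + 1) + k) := by
  have hloop : LoopInvariant 6 (.add (.load (.const 0)) (.const 1))
      (.rstore (.add (termAddress 4) (.load (.const 6)))
        (.load (.add (termAddress 5) (.load (.const 6))))) (n + 1) 30
      fun l M' => M'.int = Function.update M.int 6 l ∧ ∀ j, ∀ k ≤ n, M'.real (j * (n + 1) + k) =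
        M.real ((if j = c ∧ k < l then i else j) * (n + 1) + k) :=
    { counter := fun l M' h => by simp [h.1]
      bound := fun l M' h => by simp [IExpr.eval, h.1, hn]
      body := fun l M' hl ⟨hint, hreal⟩ => by
        refine ⟨_, _, .rstore _ _ _, ?_, by simp [Mem.setReal, hint], ?_, fun j k hk => ?_⟩
        · simp only [IExpr.cost, RExpr.cost, termAddress]; omega
        · simp [Mem.setReal, Mem.setInt, hint]
        · have hsource := hreal i l (by omega)
          simp only [lt_self_iff_false, and_false, if_false] at hsource
          simp only [Mem.setInt, Mem.setReal, hint, IExpr.eval, termAddress, ne_eq,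
            Nat.reduceEqDiff, not_false_eq_true, Function.update_of_ne, hc, OfNat.zero_ne_ofNat, hn,
            Function.update_self, RExpr.eval, hi, hsource, Function.update_apply,
            mul_succ_add_inj hk (Nat.le_of_lt_succ hl), hreal j k hk]
          grind }
  obtain ⟨t, M', hrun, ht, hint, hreal⟩ := hloop.runs_forLoop (M := M)
    ⟨rfl, fun _ _ _ => by simp [Mem.setInt]⟩
  refine ⟨t, M', hrun, ?_, hint, fun j k hk => ?_⟩
  · simp only [IExpr.cost] at ht; linarith
  · simpa only [Nat.lt_succ_of_le hk, and_true] using hreal j k hk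

/-- The exponent vector of the term number `j` in the memory. -/
def Layout.exponents (L : Layout) (M : Mem) (j : ℕ) (k : Fin L.numVars) : ℝ :=
  M.real (j * (L.numVars + 1) + 1 + k)

theorem runs_appendTerm {c i : ℕ} {M : Mem} (hn : M.int 0 = L.numVars) (hc : M.int 4 = c)
    (hi : M.int 5 = i) :
    ∃ t M', Runs appendTerm M t M' ∧ t ≤ 120 * (L.numVars + 1) ∧
      M'.int = Function.update (Function.update M.int 6 (L.numVars + 1)) 4 (c + 1) ∧
      (∀ j, M'.real (j * (L.numVars + 1)) =
        if j = c then 0 else M.real (j * (L.numVars + 1))) ∧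
      ∀ j, L.exponents M' j = L.exponents M (if j = c then i else j) := by
  obtain ⟨t, M', hrun, ht, hint, hreal⟩ := runs_copyTerm hn hc hi
  have haddress : (termAddress 4).eval M' = c * (L.numVars + 1) + 0 := by
    simp [termAddress, IExpr.eval, hint, hc, hn]
  refine ⟨_, _, hrun.seq (.seq (.rstore _ _ _) (.istore _ _ _)), ?_, ?_, fun j => ?_, fun j => ?_⟩
  · simp only [IExpr.cost, RExpr.cost, termAddress]; omega
  · simp [Mem.setInt, Mem.setReal, IExpr.eval, hint, hc]
  · have hinj : j * (L.numVars + 1) = c * (L.numVars + 1) + 0 ↔ j = c := by simp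
    simp only [Mem.setInt, Mem.setReal, haddress, Function.update_apply, hinj, RExpr.eval]
    split_ifs with hj
    · simp
    · simpa [hj] using hreal j 0 (Nat.zero_le _)
  · ext k
    have hk : 1 + (k : ℕ) ≤ L.numVars := by omega
    simp only [Layout.exponents, Mem.setInt, Mem.setReal, haddress, Function.update_apply,
      add_assoc, mul_succ_add_inj hk (Nat.zero_le _), hreal j _ hk]
    simp

/-- After `i` rounds of `compact`, the terms below `i` which satisfy `K` have been moved to the
front and the terms from `i` on are still in their places. -/
structure CompactedUpTo (L : Layout) (K : ℕ → Prop) [DecidablePred K] (i : ℕ) (M : Mem) :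
    Prop where
  numVars : M.int 0 = L.numVars
  numTerms : M.int 1 = L.numTerms
  count : M.int 4 = Nat.count K i
  index : M.int 5 = i
  mark : ∀ p < L.numTerms, 1 ≤ M.int (9 + 3 * p) ↔ K p
  coeff : ∀ j < Nat.count K i, M.real (j * (L.numVars + 1)) = 0
  moved : ∀ j < Nat.count K i, L.exponents M j = L.point (Nat.nth K j)
  unmoved : ∀ j, i ≤ j → j < L.numTerms → L.exponents M j = L.point j

namespace CompactedUpTo

variable {K : ℕ → Prop} [DecidablePred K] {i : ℕ} {M : Mem}

theorem of_not (h : CompactedUpTo L K i M) (hK : ¬ K i) :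
    CompactedUpTo L K (i + 1) (M.setInt 5 (i + 1)) where
  numVars := h.numVars
  numTerms := h.numTerms
  count := by simpa [Mem.setInt, Nat.count_succ, hK] using h.count
  index := by simp [Mem.setInt]
  mark p hp := by simpa [Mem.setInt, show 9 + 3 * p ≠ 5 by omega] using h.mark p hp
  coeff j hj := h.coeff j (by simpa [Nat.count_succ, hK] using hj)
  moved j hj := h.moved j (by simpa [Nat.count_succ, hK] using hj)
  unmoved j hj := h.unmoved j (by omega)

theorem runs_appendTerm (h : CompactedUpTo L K i M) (hi : i < L.numTerms) (hK : K i) :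
    ∃ t M', Runs appendTerm M t M' ∧ t ≤ 120 * (L.numVars + 1) ∧ M'.int 5 = i ∧
      CompactedUpTo L K (i + 1) (M'.setInt 5 (i + 1)) := by
  obtain ⟨t, M', hrun, ht, hint, hcoeff, hexp⟩ := RealRAM.runs_appendTerm h.numVars h.count h.index
  have hcount : Nat.count K (i + 1) = Nat.count K i + 1 := by simp [Nat.count_succ, hK]
  refine ⟨t, M', hrun, ht, by simp [hint, h.index], ?_⟩
  exact
    { numVars := by simpa [Mem.setInt, hint] using h.numVars
      numTerms := by simpa [Mem.setInt, hint] using h.numTerms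
      count := by simp [Mem.setInt, hint, hcount]
      index := by simp [Mem.setInt]
      mark := fun p hp => by
        simpa [Mem.setInt, hint, show 9 + 3 * p ≠ 5 by omega, show 9 + 3 * p ≠ 4 by omega,
          show 9 + 3 * p ≠ 6 by omega] using h.mark p hp
      coeff := fun j hj => by
        have := h.coeff j
        have := hcoeff j
        grind [Mem.setInt]
      moved := fun j hj => by
        change L.exponents M' j = _
        rw [hexp]
        split_ifs with hj'
        · rw [hj', Nat.nth_count hK, h.unmoved i le_rfl hi]
        · exact h.moved j (by omega)
      unmoved := fun j hj hjN => by
        have hle : Nat.count K i ≤ i := Nat.count_le _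
        change L.exponents M' j = _
        rw [hexp, if_neg (by omega), h.unmoved j (by omega) hjN] }

end CompactedUpTo

theorem runs_compact {M : Mem} {σ : State L} (hM : Represents M σ) {K : ℕ → Prop}
    [DecidablePred K] (hK : ∀ p < L.numTerms, σ.cursor p ≠ 0 ↔ K p) :
    ∃ t M', Runs compact M t M' ∧ t ≤ 200 * ((L.numTerms + 1) * (L.numVars + 1)) ∧
      M'.int 0 = L.numVars ∧ M'.int 1 = Nat.count K L.numTerms ∧
      ∀ j < Nat.count K L.numTerms,
        M'.real (j * (L.numVars + 1)) = 0 ∧ L.exponents M' j = L.point (Nat.nth K j) := by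
  have hloop : LoopInvariant 5 (.load (.const 1))
      (.ite (.ile (.const 1) (.load (cursorAddress (.load (.const 5))))) appendTerm .skip)
      L.numTerms (140 * (L.numVars + 1)) (CompactedUpTo L K) :=
    { counter := fun i M' h => h.index
      bound := fun i M' h => h.numTerms
      body := fun i M' hi h => by
        have htest : (Test.ile (.const 1) (.load (cursorAddress (.load (.const 5))))).Holds M' ↔
            K i := by
          simpa [Test.Holds, IExpr.eval, cursorAddress, h.index] using h.mark i hi
        by_cases hKi : K i
        · obtain ⟨t, M'', hrun, ht, hindex, h'⟩ := h.runs_appendTerm hi hKi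
          refine ⟨_, M'', .ite_true (htest.2 hKi) hrun, ?_, hindex, h'⟩
          simp only [Test.cost, IExpr.cost, cursorAddress]; omega
        · refine ⟨_, M', .ite_false (mt htest.1 hKi) (.skip _), ?_, h.index, h.of_not hKi⟩
          simp only [Test.cost, IExpr.cost, cursorAddress]; omega }
  have hstart : CompactedUpTo L K 0 ((M.setInt 4 0).setInt 5 0) :=
    { numVars := hM.numVars
      numTerms := hM.numTerms
      count := by simp [Mem.setInt]
      index := by simp [Mem.setInt]
      mark := fun p hp => by
        rw [← hK p hp, Nat.one_le_iff_ne_zero, show σ.cursor p = M.int (9 + 3 * p) from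
          (hM.cell (.cursor p)).symm]
        simp [Mem.setInt, show 9 + 3 * p ≠ 5 by omega, show 9 + 3 * p ≠ 4 by omega]
      coeff := by simp
      moved := by simp
      unmoved := fun j _ hj => funext (hM.real_point hj) }
  obtain ⟨t, M', hrun, ht, h⟩ := hloop.runs_forLoop hstart
  refine ⟨_, _, .seq (.istore _ _ _) (.seq hrun (.istore _ _ _)), ?_, ?_, ?_, fun j hj => ?_⟩
  · simp only [IExpr.cost] at ht ⊢
    nlinarith
  · simpa [Mem.setInt, IExpr.eval] using h.numVars
  · simp [Mem.setInt, IExpr.eval, h.count]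
  · exact ⟨h.coeff j hj, h.moved j hj⟩

/-! ### The whole program -/

/-- Makes the cursors of the minimal vertices, and of no other input points, non-zero. -/
def findMinimalVertices : Prog := .seq findVertices findMinimal

/-- The program that computes `sMin`. -/
def minProg : Prog :=
  .seq (.istore (.const 2) (.mul (.load (.const 1)) (.add (.load (.const 0)) (.const 1))))
    (.seq (.istore (.const 3) (.add (.load (.const 0)) (.sub (.const 2) (.load (.const 0)))))
      (.seq findMinimalVertices compact))

/-- The input point `p` is a vertex of the convex hull of all input points. -/
def Layout.IsVertex (L : Layout) (p : ℕ) : Prop := Feasible (L.diff p) (L.numTerms - 1)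

theorem searchTime_le {n N : ℕ} (hN : 1 ≤ N) :
    N * (solveTime (max 2 n - 2) (N - 1) + 15 * N + 1) + 1 + (N * (N * 7 + 2 + 1 + 1) + 1) ≤
      500 * N ^ max 2 n := by
  have hsolve := solveTime_le (max 2 n - 2) (N - 1)
  rw [show N - 1 + 1 = N by omega, show max 2 n - 2 + 1 = max 2 n - 1 by omega] at hsolve
  have hpow : N ^ max 2 n = N * N ^ (max 2 n - 1) := by
    rw [← pow_succ', show max 2 n - 1 + 1 = max 2 n by omega]
  have hle : N ≤ N ^ (max 2 n - 1) := Nat.le_self_pow (by omega) N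
  rw [hpow]
  generalize N ^ (max 2 n - 1) = X at *
  have hvertices := Nat.mul_le_mul_left N (show solveTime (max 2 n - 2) (N - 1) + 15 * N + 1 ≤
    416 * X by omega)
  have hminimal := Nat.mul_le_mul_left N (show N * 7 + 2 + 1 + 1 ≤ 11 * X by omega)
  have hNX : 1 ≤ N * X := Nat.mul_pos hN (hN.trans hle)
  linarith

theorem HaltsWithin.findMinimalVertices (hN : 1 ≤ L.numTerms) (σ : State L) :
    HaltsWithin RealRAM.findMinimalVertices σ (500 * L.numTerms ^ max 2 L.numVars) fun σ' =>
      ∀ p < L.numTerms, σ'.cursor p ≠ 0 ↔ L.IsMinimal L.IsVertex p := by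
  refine (seq (findVertices fun τ hτ => findMinimal fun τ' hτ' p hp =>
    (hτ' p hp).trans ?_)).mono_time (searchTime_le hN)
  exact and_congr (hτ p hp) (forall₂_congr fun q hq => imp_congr_left (hτ q hq))

theorem exists_represents {M : Mem} (hn : M.int 0 = L.numVars) (hN : M.int 1 = L.numTerms)
    (hbase : M.int 2 = L.base) (htop : M.int 3 = L.topLevel)
    (hinput : ∀ a < L.base, M.real a = L.input a) : ∃ σ : State L, Represents M σ :=
  ⟨{  reg r := M.int (Cell.reg r).address
      cursor l := M.int (Cell.cursor l).address
      flag p := M.int (Cell.flag p).address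
      scalar s := M.real (L.scalarAddress s)
      vec l i k := M.real (L.vecAddress l i k) },
    hn, hN, hbase, htop, fun c => by cases c <;> rfl, hinput, fun _ => rfl, fun _ _ _ => rfl⟩

open Classical in
theorem runs_minProg (hnL : 1 ≤ L.numVars) (hNL : 1 ≤ L.numTerms) {M : Mem}
    (hn : M.int 0 = L.numVars) (hN : M.int 1 = L.numTerms)
    (hinput : ∀ a < L.base, M.real a = L.input a) :
    ∃ t M', Runs minProg M t M' ∧ t ≤ 1000830 * L.numVars * L.numTerms ^ max 2 L.numVars ∧
      M'.int 0 = L.numVars ∧ M'.int 1 = Nat.count (L.IsMinimal L.IsVertex) L.numTerms ∧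
      ∀ j < Nat.count (L.IsMinimal L.IsVertex) L.numTerms, M'.real (j * (L.numVars + 1)) = 0 ∧
        L.exponents M' j = L.point (Nat.nth (L.IsMinimal L.IsVertex) j) := by
  obtain ⟨σ, hσ⟩ : ∃ σ : State L,
      Represents ((M.setInt 2 L.base).setInt 3 L.topLevel) σ :=
    exists_represents (by simpa [Mem.setInt] using hn) (by simpa [Mem.setInt] using hN)
      (by simp [Mem.setInt]) (by simp [Mem.setInt]) hinput
  obtain ⟨t₁, M₁, τ, hsearch, ht₁, hτ, hcursor⟩ :=
    HaltsWithin.findMinimalVertices hNL σ _ hσ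
  obtain ⟨t₂, M₂, hcompact, ht₂, hM₂⟩ := runs_compact hτ hcursor
  have hbase : L.base = M.int 1 * (M.int 0 + 1) := by rw [hn, hN, Layout.base]
  have htop : L.topLevel = M.int 0 + (2 - M.int 0) := by rw [hn, Layout.topLevel]; omega
  rw [hbase, htop] at hsearch
  refine ⟨_, M₂, .seq (.istore ..) (.seq (.istore ..) (.seq hsearch hcompact)), ?_, hM₂⟩
  simp only [IExpr.cost]
  have hle : L.numTerms ≤ L.numTerms ^ max 2 L.numVars := Nat.le_self_pow (by omega) _
  calc
    _ ≤ 500 * L.numTerms ^ max 2 L.numVars * L.unit +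
        200 * ((L.numTerms + 1) * (L.numVars + 1)) + 30 := by omega
    _ ≤ 500 * L.numTerms ^ max 2 L.numVars * (2000 * L.numVars) +
        200 * (2 * L.numTerms ^ max 2 L.numVars * (2 * L.numVars)) +
        30 * (L.numVars * L.numTerms ^ max 2 L.numVars) := by
      have hunit : L.unit ≤ 2000 * L.numVars := by unfold Layout.unit; omega
      have hpos : 1 ≤ L.numVars * L.numTerms ^ max 2 L.numVars := Nat.mul_pos hnL (hNL.trans hle)
      gcongr <;> omega
    _ = 1000830 * L.numVars * L.numTerms ^ max 2 L.numVars := by ring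

theorem forall_skip_iff {P : ℕ → Prop} {p m : ℕ} (hp : p < m) :
    (∀ j < m - 1, P (if j < p then j else j + 1)) ↔ ∀ q < m, q ≠ p → P q := by
  constructor
  · intro h q hq hqp
    rcases hqp.lt_or_gt with hlt | hgt
    · simpa [hlt] using h q (by omega)
    · simpa [show ¬ q - 1 < p by omega, show q - 1 + 1 = q by omega] using h (q - 1) (by omega)
  · intro h j hj
    exact h _ (by split <;> omega) (by split <;> omega)

section Correctness

variable {s : MvPolynomial (Fin L.numVars) 𝕋} {e : Fin L.numTerms ≃ s.support}

theorem isVertex_iff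
    (he : ∀ p : Fin L.numTerms, L.point p = toPoint (e p : Fin L.numVars →₀ ℕ))
    (p : Fin L.numTerms) : L.IsVertex p ↔ (e p : Fin L.numVars →₀ ℕ) ∈ vertNP s := by
  rw [mem_vertNP_iff (e p).2]
  refine exists_congr fun w => ?_
  simp only [Layout.diff]
  rw [forall_skip_iff (P := fun q => 0 < w ⬝ᵥ (L.point q - L.point p)) p.2]
  constructor
  · intro h ν hν hne
    obtain ⟨q, hq⟩ := e.surjective ⟨ν, hν⟩
    obtain rfl : (e q : Fin L.numVars →₀ ℕ) = ν := congrArg Subtype.val hq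
    rw [← he, ← he]
    exact h q q.2 fun hqp => hne (by rw [Fin.ext hqp])
  · intro h q hq hqp
    have hpos := h (e ⟨q, hq⟩) (e ⟨q, hq⟩).2 fun heq =>
      hqp (congrArg Fin.val (e.injective (Subtype.ext heq)))
    rwa [← he, ← he] at hpos

theorem isMinimal_iff
    (he : ∀ p : Fin L.numTerms, L.point p = toPoint (e p : Fin L.numVars →₀ ℕ))
    (p : Fin L.numTerms) :
    L.IsMinimal L.IsVertex p ↔ (e p : Fin L.numVars →₀ ℕ) ∈ vertNPmin s := by
  have hle (q : Fin L.numTerms) :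
      L.point q ≤ L.point p ↔ (e q : Fin L.numVars →₀ ℕ) ≤ e p := by
    rw [he, he, Finsupp.le_def]
    simp only [Pi.le_def, toPoint, Nat.cast_le]
  constructor
  · rintro ⟨hvertex, hmin⟩
    refine ⟨(isVertex_iff he p).1 hvertex, fun ν hν hνp => ?_⟩
    obtain ⟨q, hq⟩ := e.surjective ⟨ν, vertNP_subset_support s hν⟩
    obtain rfl : (e q : Fin L.numVars →₀ ℕ) = ν := congrArg Subtype.val hq
    by_contra hpq
    exact hmin q q.2 ((isVertex_iff he q).2 hν) (fun hqp => hpq (by rw [Fin.ext hqp]))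
      ((hle q).2 hνp)
  · rintro ⟨hvertex, hmin⟩
    refine ⟨(isVertex_iff he p).2 hvertex, fun q hq hqvertex hqp hqle => hqp ?_⟩
    have hle' := (hle ⟨q, hq⟩).1 hqle
    have hge := hmin ((isVertex_iff he ⟨q, hq⟩).1 hqvertex) hle'
    exact congrArg Fin.val (e.injective (Subtype.ext (le_antisymm hle' hge)))

end Correctness

theorem exists_equiv_of_count {α : Type*} {S T : Finset α} {N : ℕ} (e : Fin N ≃ S) (hTS : T ⊆ S)
    {K : ℕ → Prop} [DecidablePred K] (hK : ∀ p : Fin N, K p ↔ (e p : α) ∈ T) :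
    ∃ e' : Fin (Nat.count K N) ≃ T, ∀ j : Fin (Nat.count K N),
      ∃ p : Fin N, (p : ℕ) = Nat.nth K j ∧ (e' j : α) = e p := by
  have hlt (j : Fin (Nat.count K N)) : Nat.nth K j < N := Nat.nth_lt_of_lt_count j.2
  have hcard (j : Fin (Nat.count K N)) (hf : (Set.ofPred K).Finite) :
      (j : ℕ) < hf.toFinset.card :=
    j.2.trans_le (Nat.count_le_card hf N)
  let f (j : Fin (Nat.count K N)) : T :=
    ⟨e ⟨_, hlt j⟩, (hK ⟨_, hlt j⟩).1 (Nat.nth_mem _ (hcard j))⟩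
  have hf : f.Bijective := by
    refine ⟨fun i j hij => ?_, fun x => ?_⟩
    · have hij : (e ⟨_, hlt i⟩ : α) = e ⟨_, hlt j⟩ :=
        congrArg (fun x : T => (x : α)) hij
      have hnth : Nat.nth K i = Nat.nth K j :=
        congrArg Fin.val (e.injective (Subtype.ext hij))
      rw [Fin.ext_iff, ← Nat.count_nth (hcard i), hnth, Nat.count_nth (hcard j)]
    · obtain ⟨p, hp⟩ := e.surjective ⟨x, hTS x.2⟩
      have hKp : K p := (hK p).2 (by simp [hp])
      refine ⟨⟨Nat.count K p, Nat.count_strict_mono hKp p.2⟩, Subtype.ext ?_⟩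
      simp [f, Nat.nth_count hKp, hp]
  exact ⟨.ofBijective f hf, fun j => ⟨⟨_, hlt j⟩, rfl, rfl⟩⟩

theorem exists_runs_minProg {n : ℕ} (hn : 1 ≤ n) {s : MvPolynomial (Fin n) 𝕋} (hs : s ≠ 0)
    {M : Mem} (hM : Stores M s) :
    ∃ t M', Runs minProg M t M' ∧ t ≤ 1000830 * n * s.support.card ^ max 2 n ∧
      Stores M' (sMin s) := by
  classical
  obtain ⟨hvars, hterms, e, he⟩ := hM
  let L : Layout := ⟨n, s.support.card, M.real⟩
  have hpoint (p : Fin L.numTerms) : L.point p = toPoint (e p : Fin n →₀ ℕ) :=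
    funext (he p).2
  obtain ⟨t, M', hrun, ht, hvars', hcount, hout⟩ := runs_minProg (L := L) hn
    (Finset.card_pos.2 (MvPolynomial.support_nonempty.2 hs)) hvars hterms fun _ _ => rfl
  obtain ⟨e', he'⟩ := exists_equiv_of_count (T := (sMin s).support) e
    (fun μ hμ => vertNPmin_subset_support s (mem_support_sMin.1 hμ))
    (fun p => (isMinimal_iff hpoint p).trans mem_support_sMin.symm)
  have hcard : (sMin s).support.card = Nat.count (L.IsMinimal L.IsVertex) L.numTerms := by
    simpa using (Fintype.card_congr e').symm
  refine ⟨t, M', hrun, ht, hvars', hcount.trans hcard.symm, (finCongr hcard).trans e',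
    fun i => ?_⟩
  obtain ⟨hcoeff, hexponents⟩ := hout i (hcard ▸ i.2)
  obtain ⟨p, hp, hμ⟩ := he' (finCongr hcard i)
  constructor
  · rw [coeff_sMin, if_pos (mem_support_sMin.1 (Subtype.prop _)), Tropical.untrop_one]
    simpa using hcoeff
  · intro k
    change M'.real (i * (n + 1) + 1 + k) = toPoint _ k
    rw [Equiv.trans_apply, hμ, ← congrFun (hpoint p) k, hp]
    exact congrFun hexponents k

end RealRAM

theorem mainTheorem6_general :
    ∃ (P : RealRAM.Prog) (C : ℕ), ∀ (n : ℕ) (s : MvPolynomial (Fin n) TropPoly.𝕋),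
      TropPoly.toPoint '' ((TropPoly.sMin s).support : Set (Fin n →₀ ℕ)) =
          Set.extremePoints ℝ (TropPoly.NPmin s) ∧
      (1 ≤ n → s ≠ 0 → ∀ M : RealRAM.Mem, RealRAM.Stores M s →
        ∃ t M', RealRAM.Runs P M t M' ∧ t ≤ C * n * s.support.card ^ max 2 n ∧
          RealRAM.Stores M' (TropPoly.sMin s)) :=
  ⟨RealRAM.minProg, 1000830, fun _ s => ⟨TropPoly.image_support_sMin s,
    fun hn hs _ => RealRAM.exists_runs_minProg hn hs⟩⟩

theorem mainTheorem6 :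
    ∃ (P : RealRAM.Prog) (C : ℕ),
      ∀ (n : ℕ) (s : MvPolynomial (Fin n) TropPoly.𝕋), 1 ≤ n → s ≠ 0 →
        TropPoly.toPoint '' ((TropPoly.sMin s).support : Set (Fin n →₀ ℕ)) =
            Set.extremePoints ℝ (TropPoly.NPmin s) ∧
        ∀ M : RealRAM.Mem, RealRAM.Stores M s →
          RealRAM.haltProb P M {M' | RealRAM.Stores M' (TropPoly.sMin s)} = 1 ∧
          RealRAM.expectedTime P M ≤
            (C : ENNReal) * (n : ENNReal) * (s.support.card : ENNReal) ^ (max 2 n) := by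
  obtain ⟨P, C, h⟩ := mainTheorem6_general
  refine ⟨P, C, fun n s hn hs => ⟨(h n s).1, fun M hM => ?_⟩⟩
  obtain ⟨t, M', hrun, ht, hM'⟩ := (h n s).2 hn hs M hM
  exact ⟨hrun.haltProb_eq_one hM', hrun.expectedTime_eq.trans_le (by exact_mod_cast ht)⟩
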